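/- Let $p,q\ge 2$ be integers. For real $\beta,h$ and $N\ge 1$, let $\mathbb P_{\beta,h,N}$ be the probability measure on $[q]^N$ with $$\mathbb P_{\beta,h,N}(\boldsymbol X)\propto \exp\Big(\beta N\sum_{r=1}^q \bar X_{\cdot r}^{\,p}+Nh\bar X_{\cdot 1}\Big),\qquad \bar X_{\cdot r}=\frac1N\sum_{i=1}^N \mathbf 1\{X_i=r\},$$ and let $\bar{\boldsymbol X}_N=(\bar X_{\cdot 1},\dots,\bar X_{\cdot q})$. On the set $\mathcal P_q$ of probability vectors put $H_{\beta,h}(\boldsymbol t)=\beta\sum_r t_r^p+ht_1-\sum_r t_r\log t_r$ (with $0\log 0=0$). Let $\mathcal H_q=\{\boldsymbol t\in\mathbb R^q:\sum_r t_r=0\}$, $k(x)=\beta x^p-x\log x$, $\boldsymbol x_s=\big(\tfrac{1+(q-1)s}{q},\tfrac{1-s}{q},\dots,\tfrac{1-s}{q}\big)$ for $s\in[0,1)$, and $f_{\beta,h}(s)=H_{\beta,h}(\boldsymbol x_s)$. A point $(\beta,h)\in(0,\infty)\times[0,\infty)$ is *special* if $H_{\beta,h}$ has a unique global maximizer $\boldsymbol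 m_*$ on $\mathcal P_q$ and the quadratic form $\boldsymbol t\mapsto\sum_{r}\big(\beta p(p-1)m_{*,r}^{p-2}-1/m_{*,r}\big)t_r^2$ vanishes at some nonzero $\boldsymbol t\in\mathcal H_q$. A special point is of *type I* if $f^{(4)}_{\beta,h}(s)<0$ for the $s\in[0,1)$ with $\boldsymbol m_*=\boldsymbol x_s$. **Theorem.** Let $(\beta,h)$ be type-I special with unique global maximizer $\boldsymbol m_*$ of $H_{\beta,h}$, and let $\boldsymbol u=(1-q,1,\dots,1)$. Then $\boldsymbol m_*=\boldsymbol x_s$ for some $s\in[0,1)$. For every $N\ge1$ and every configuration there exist a unique $T_N\in\mathbb R$ and a unique $\boldsymbol V_N\in\mathcal H_q\cap\operatorname{Span}(\boldsymbol u)^\perp$ with $$\bar{\boldsymbol X}_N-\boldsymbol m_*=N^{-1/4}T_N\boldsymbol u+N^{-1/2}\boldsymbol V_N .$$ Let $\bar\beta,\bar h\in\mathbb R$. Then, under $\boldsymbol X\sim\mathbb P_{\beta+N^{-3/4}\bar\beta,\;h+N^{-3/4}\bar h,\;N}$, as $N\to\infty$, $$T_N\xrightarrow{D}T,\qquad \boldsymbol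 V_N\xrightarrow{D}\boldsymbol V,\qquad (T_N,\boldsymbol V_N)\xrightarrow{D}(T,\boldsymbol V),$$ where $T$ and $\boldsymbol V$ are independent, $T$ has density at $x$ proportional to $$\exp\Big(\frac{x^4}{24}q^4f^{(4)}_{\beta,h}(s)+\Big(\bar\beta p\sum_{r=1}^q m_{*,r}^{p-1}u_r+\bar h(1-q)\Big)x\Big),$$ and $\boldsymbol V$ is a centered Gaussian vector in $\mathbb R^q$ whose covariance matrix has rank $q-2$ and equals $$\frac{1}{-(q-1)\,k''\!\left(\frac{1-s}{q}\right)}\begin{bmatrix}0&0&\cdots&0\\0&q-2&\cdots&-1\\\vdots&\vdots&\ddots&\vdots\\0&-1&\cdots&q-2\end{bmatrix}$$ (zero first row and column, $q-2$ on the remaining diagonal, $-1$ elsewhere). For $q=2$ this covariance matrix is read as the zero matrix. -/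

import Mathlib

open MeasureTheory ProbabilityTheory Filter Topology

noncomputable section

namespace Potts

/-- The space `ℝ^q` with its Euclidean structure; color `1` of `[q]` is the index `0 : Fin q`. -/
abbrev Vec (q : ℕ) : Type := EuclideanSpace ℝ (Fin q)

/-- `X̄_{·r} = N⁻¹ ∑ᵢ 𝟙{Xᵢ = r}`, the empirical magnetization vector of a configuration. -/
def magnetization (q N : ℕ) (X : Fin N → Fin q) : Vec q :=
  WithLp.toLp 2 fun r => (N : ℝ)⁻¹ * ∑ i : Fin N, if X i = r then (1 : ℝ) else 0

/-- The unnormalized weight `exp (β N ∑ᵣ X̄_{·r}^p + N h X̄_{·1})` of a configuration. -/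
def weight (p q : ℕ) [NeZero q] (β h : ℝ) (N : ℕ) (X : Fin N → Fin q) : ℝ :=
  Real.exp (β * N * ∑ r : Fin q, magnetization q N X r ^ p + N * h * magnetization q N X 0)

theorem sum_weight_pos (p q : ℕ) [NeZero q] (β h : ℝ) (N : ℕ) :
    0 < ∑ Y : Fin N → Fin q, weight p q β h N Y :=
  Finset.sum_pos (fun _ _ => Real.exp_pos _) ⟨fun _ => 0, Finset.mem_univ _⟩

theorem sum_weight_div (p q : ℕ) [NeZero q] (β h : ℝ) (N : ℕ) :
    ∑ X : Fin N → Fin q,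
      ENNReal.ofReal (weight p q β h N X / ∑ Y : Fin N → Fin q, weight p q β h N Y) = 1 := by
  have hnn : ∀ X ∈ (Finset.univ : Finset (Fin N → Fin q)),
      0 ≤ weight p q β h N X / ∑ Y : Fin N → Fin q, weight p q β h N Y :=
    fun X _ => div_nonneg (Real.exp_pos _).le (sum_weight_pos p q β h N).le
  rw [← ENNReal.ofReal_sum_of_nonneg hnn,
    ← Finset.sum_div, div_self (sum_weight_pos p q β h N).ne', ENNReal.ofReal_one]

/-- The `p`-tensor Curie-Weiss Potts probability mass function on `[q]^N`. -/
def pottsPMF (p q : ℕ) [NeZero q] (β h : ℝ) (N : ℕ) : PMF (Fin N → Fin q) :=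
  PMF.ofFintype
    (fun X => ENNReal.ofReal (weight p q β h N X / ∑ Y : Fin N → Fin q, weight p q β h N Y))
    (sum_weight_div p q β h N)

/-- The `p`-tensor Curie-Weiss Potts measure `ℙ_{β,h,N}`. It makes sense for all real `β` and `h`,
as is needed for perturbed parameters. -/
def pottsMeasure (p q : ℕ) [NeZero q] (β h : ℝ) (N : ℕ) : Measure (Fin N → Fin q) :=
  (pottsPMF p q β h N).toMeasure

instance (p q : ℕ) [NeZero q] (β h : ℝ) (N : ℕ) :
    IsProbabilityMeasure (pottsMeasure p q β h N) :=
  inferInstanceAs (IsProbabilityMeasure (pottsPMF p q β h N).toMeasure)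

/-- The set of `q`-dimensional probability vectors. -/
def probVectors (q : ℕ) : Set (Vec q) := {t | (∀ r, 0 ≤ t r) ∧ ∑ r, t r = 1}

/-- The negative free energy `H_{β,h}` (with `0 log 0 = 0`). -/
def negFreeEnergy (p q : ℕ) [NeZero q] (β h : ℝ) (t : Vec q) : ℝ :=
  β * ∑ r, t r ^ p + h * t 0 - ∑ r, t r * Real.log (t r)

/-- `m` is a global maximizer of `H_{β,h}` over the probability vectors. -/
def IsGlobalMaximizer (p q : ℕ) [NeZero q] (β h : ℝ) (m : Vec q) : Prop :=
  m ∈ probVectors q ∧ ∀ t ∈ probVectors q, negFreeEnergy p q β h t ≤ negFreeEnergy p q β h m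

/-- The hyperplane of the vectors of `ℝ^q` whose coordinates add up to zero. -/
def zeroSum (q : ℕ) : Submodule ℝ (Vec q) where
  carrier := {t | ∑ r, t r = 0}
  add_mem' {a b} ha hb := by
    simp only [Set.mem_ofPred_eq, PiLp.add_apply, Finset.sum_add_distrib] at *
    rw [ha, hb, add_zero]
  zero_mem' := by simp
  smul_mem' c a ha := by
    simp only [Set.mem_ofPred_eq, PiLp.smul_apply, smul_eq_mul, ← Finset.mul_sum] at *
    rw [ha, mul_zero]

/-- The quadratic form `Q_{s,β}(t) = ∑ᵣ (β p (p-1) sᵣ^(p-2) - 1/sᵣ) tᵣ²`. -/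
def quadForm (p q : ℕ) (β : ℝ) (s t : Vec q) : ℝ :=
  ∑ r, (β * p * (p - 1) * s r ^ (p - 2) - 1 / s r) * t r ^ 2

/-- `(β,h)` is a special point of the parameter space `(0,∞) × [0,∞)`: `H_{β,h}` has a unique
global maximizer, and there the quadratic form vanishes at some nonzero vector of the zero-sum
hyperplane (the form is negative semidefinite on that hyperplane at a maximizer, so this says that
its restriction to the hyperplane is singular). -/
def IsSpecial (p q : ℕ) [NeZero q] (β h : ℝ) : Prop :=
  0 < β ∧ 0 ≤ h ∧ ∃ m : Vec q, IsGlobalMaximizer p q β h m ∧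
    (∀ m' : Vec q, IsGlobalMaximizer p q β h m' → m' = m) ∧
    ∃ t ∈ zeroSum q, t ≠ 0 ∧ quadForm p q β m t = 0

/-- `x_s = ((1+(q-1)s)/q, (1-s)/q, …, (1-s)/q)`. -/
def xvec (q : ℕ) [NeZero q] (s : ℝ) : Vec q :=
  WithLp.toLp 2 fun r => if r = 0 then (1 + (q - 1) * s) / q else (1 - s) / q

/-- `f_{β,h}(s) = H_{β,h}(x_s)`. -/
def profile (p q : ℕ) [NeZero q] (β h : ℝ) (s : ℝ) : ℝ :=
  negFreeEnergy p q β h (xvec q s)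

/-- `k_{β,p}(x) = β x^p - x log x`. -/
def kfun (p : ℕ) (β : ℝ) (x : ℝ) : ℝ := β * x ^ p - x * Real.log x

/-- `(β,h)` is type-I special: it is special, and the unique global maximizer `x_s`
with `s ∈ [0,1)` satisfies `f_{β,h}⁗(s) < 0`. -/
def IsTypeISpecial (p q : ℕ) [NeZero q] (β h : ℝ) : Prop :=
  IsSpecial p q β h ∧ ∀ s ∈ Set.Ico (0 : ℝ) 1, IsGlobalMaximizer p q β h (xvec q s) →
    iteratedDeriv 4 (profile p q β h) s < 0

/-- `u = (1-q, 1, …, 1)`. -/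
def uvec (q : ℕ) [NeZero q] : Vec q :=
  WithLp.toLp 2 fun r => if r = 0 then 1 - (q : ℝ) else 1

/-- `X̄_N - m = N^(-1/4) t u + N^(-1/2) v` with `v` in the zero-sum hyperplane and orthogonal
to `u`. -/
def IsDecomposition (q : ℕ) [NeZero q] (N : ℕ) (m : Vec q) (X : Fin N → Fin q)
    (t : ℝ) (v : Vec q) : Prop :=
  v ∈ zeroSum q ⊓ (Submodule.span ℝ {uvec q})ᗮ ∧
    magnetization q N X - m =
      ((N : ℝ) ^ (-(1 / 4) : ℝ) * t) • uvec q + ((N : ℝ) ^ (-(1 / 2) : ℝ)) • v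

/-- `exp (x⁴/24 q⁴ f_{β,h}⁗(s) + (β̄ p ⟨m^(p-1), u⟩ + h̄ (1-q)) x)` with `m = x_s`. -/
def limitDensity (p q : ℕ) [NeZero q] (β h βbar hbar s : ℝ) (x : ℝ) : ℝ :=
  Real.exp (x ^ 4 / 24 * q ^ 4 * iteratedDeriv 4 (profile p q β h) s +
    (βbar * p * (∑ r, xvec q s r ^ (p - 1) * uvec q r) + hbar * (1 - q)) * x)

/-- The matrix `1 / (-(q-1) k''((1-s)/q))` times the block matrix with zero first row and column,
`q-2` on the rest of the diagonal and `-1` elsewhere. If `q = 2` the block matrix is zero, and so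
is this one, even when `k''((1-s)/q) = 0`. -/
def limitCov (p q : ℕ) [NeZero q] (β s : ℝ) : Matrix (Fin q) (Fin q) ℝ :=
  (1 / (-((q : ℝ) - 1) * iteratedDeriv 2 (kfun p β) ((1 - s) / q))) •
    Matrix.of fun r r' =>
      if r = 0 ∨ r' = 0 then (0 : ℝ) else if r = r' then (q : ℝ) - 2 else -1

end Potts

end

/-! Write `q = d + 1`. Permuting the coordinates changes `H` only through the field term, so a
unique maximizer is some `x_s` (`exists_eq_xvec`); `s = 1` is excluded because the entropy has
infinite slope at the boundary. On the zero-sum hyperplane the Hessian is diagonal with respect to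
`u` and its complement. On the complement its factor `k''((1-s)/q)` is strictly negative when `d ≥
2` (`kfunD2_tailCoord_neg`), so at a special point the degeneracy lies along `u`, where `H` is the
profile `f`: `f'' = 0`, hence `f''' = 0` by maximality, and type I gives `f'''' < 0`
(`IsQuarticMax.of_special`). Thus `N (H - max H)` is of order one when the displacement is
`N^(-1/4)` along `u` and `N^(-1/2)` across it, and its limit is a quartic in `t` plus a quadratic
form in `w`. The perturbation of the parameters enters with the factor `N * N^(-3/4) = N^(1/4)`, at
which only the displacement along `u` survives.

Densities come from counting. By Stirling, the total weight of all configurations with given color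
counts is an explicit prefactor times `exp (N H)` (`card_mul_weight`). Each count vector occupies a
cell of constant volume in the rescaled variables `z`, whose mean plays the part of `t` and whose
residuals play the part of `w`, so sums over configurations become integrals of step functions.
These converge pointwise, and the global bound `H - max H ≤ -c (a^4 + |w|^2)`
(`IsQuarticMax.exists_negFreeEnergy_le`) gives an integrable majorant; dominated convergence then
yields `IsQuarticMax.tendsto_expectation`.

The limiting density in `z` is a function of the mean times a Gaussian factor in the residuals. For
an isotropic Gaussian vector the mean and the residuals are independent (`map_mean_resid`);
multiplying by a Gaussian factor in the mean and dividing it out again turns this into the product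
law of `T` and `V`. -/

namespace Potts

section

/-! ### The one-variable function `k` and its derivatives -/

/-- The first derivative of `kfun`. -/
noncomputable def kfunD1 (p : ℕ) (β x : ℝ) : ℝ := β * p * x ^ (p - 1) - Real.log x - 1

/-- The second derivative of `kfun`. -/
noncomputable def kfunD2 (p : ℕ) (β x : ℝ) : ℝ := β * p * (p - 1) * x ^ (p - 2) - 1 / x

/-- The third derivative of `kfun`. -/
noncomputable def kfunD3 (p : ℕ) (β x : ℝ) : ℝ :=
  β * p * (p - 1) * ((p - 2 : ℕ) * x ^ (p - 3)) + 1 / x ^ 2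

variable {p : ℕ} {β : ℝ}

theorem hasDerivAt_kfun {x : ℝ} (hx : 0 < x) : HasDerivAt (kfun p β) (kfunD1 p β x) x := by
  have h := ((hasDerivAt_pow p x).const_mul β).sub ((hasDerivAt_id x).mul (Real.hasDerivAt_log hx.ne'))
  refine h.congr_deriv ?_
  simp only [kfunD1, id]
  field_simp
  ring

theorem hasDerivAt_kfunD1 (hp : 2 ≤ p) {x : ℝ} (hx : 0 < x) :
    HasDerivAt (kfunD1 p β) (kfunD2 p β x) x := by
  have h := (((hasDerivAt_pow (p - 1) x).const_mul (β * p)).sub (Real.hasDerivAt_log hx.ne')).sub_const 1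
  refine h.congr_deriv ?_
  have : ((p - 1 : ℕ) : ℝ) = p - 1 := by push_cast [Nat.cast_sub (by omega : 1 ≤ p)]; ring
  simp only [kfunD2, this, Nat.sub_sub]
  ring

theorem hasDerivAt_kfunD2 {x : ℝ} (hx : 0 < x) :
    HasDerivAt (kfunD2 p β) (kfunD3 p β x) x := by
  have h := ((hasDerivAt_pow (p - 2) x).const_mul (β * p * (p - 1))).sub (hasDerivAt_inv hx.ne')
  have e : kfunD2 p β = fun x => β * p * (p - 1) * x ^ (p - 2) - x⁻¹ := by
    ext y; simp [kfunD2]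
  rw [e]
  refine h.congr_deriv ?_
  simp only [kfunD3, Nat.sub_sub]
  ring

theorem continuous_kfun : Continuous (kfun p β) := by
  unfold kfun
  exact ((continuous_pow p).const_mul β |>.sub Real.continuous_mul_log)

theorem iteratedDeriv_two_kfun (hp : 2 ≤ p) {x : ℝ} (hx : 0 < x) :
    iteratedDeriv 2 (kfun p β) x = kfunD2 p β x := by
  rw [iteratedDeriv_succ, iteratedDeriv_one]
  have : deriv (kfun p β) =ᶠ[𝓝 x] kfunD1 p β := by
    filter_upwards [lt_mem_nhds hx] with y hy using (hasDerivAt_kfun hy).deriv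
  rw [this.deriv_eq]
  exact (hasDerivAt_kfunD1 hp hx).deriv

theorem kfunD3_pos (hp : 2 ≤ p) (hβ : 0 < β) {x : ℝ} (hx : 0 < x) : 0 < kfunD3 p β x := by
  have h1 : (1 : ℝ) ≤ p := by exact_mod_cast (by omega : 1 ≤ p)
  have : 0 ≤ β * p * (p - 1) * ((p - 2 : ℕ) * x ^ (p - 3)) := by
    have : 0 ≤ (p : ℝ) - 1 := by linarith
    positivity
  unfold kfunD3
  positivity

/-- Used in `kfunD2_tailCoord_neg` both to compare the curvatures at the two distinct coordinate
values of `x_s` and to identify these values when the curvatures agree. -/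
theorem strictMonoOn_kfunD2 (hp : 2 ≤ p) (hβ : 0 < β) :
    StrictMonoOn (kfunD2 p β) (Set.Ioi 0) := by
  refine strictMonoOn_of_deriv_pos (convex_Ioi 0)
    (fun x hx => (hasDerivAt_kfunD2 hx).continuousAt.continuousWithinAt) fun x hx => ?_
  rw [interior_Ioi] at hx
  rw [(hasDerivAt_kfunD2 hx).deriv]
  exact kfunD3_pos hp hβ hx

/-! ### Taylor expansions -/

/-- The Taylor expansion to the first non-vanishing order. -/
theorem isLittleO_sub_iteratedDeriv {g : ℝ → ℝ} {x : ℝ} {n : ℕ} (hn : n ≠ 0)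
    (hg : ContDiffAt ℝ n g x) (h0 : ∀ j, 1 ≤ j → j < n → iteratedDeriv j g x = 0) :
    (fun y => g y - g x - iteratedDeriv n g x / n.factorial * (y - x) ^ n)
      =o[𝓝 x] fun y => (y - x) ^ n := by
  obtain ⟨r, hr, hgr⟩ : ∃ r > 0, ContDiffOn ℝ n g (Metric.ball x r) := by
    obtain ⟨v, hv, hgv⟩ := hg.eventually (by simp) |>.exists_mem
    obtain ⟨r, hr, hrv⟩ := Metric.mem_nhds_iff.1 hv
    exact ⟨r, hr, fun y hy => (hgv y (hrv hy)).contDiffWithinAt⟩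
  have hx : x ∈ Metric.ball x r := Metric.mem_ball_self hr
  have h := taylor_isLittleO (convex_ball x r) hx hgr
  rw [Metric.isOpen_ball.nhdsWithin_eq hx] at h
  refine h.congr_left fun y => ?_
  have hj (j : ℕ) : iteratedDerivWithin j g (Metric.ball x r) x = iteratedDeriv j g x :=
    iteratedDerivWithin_of_isOpen Metric.isOpen_ball hx
  obtain ⟨n, rfl⟩ := Nat.exists_eq_succ_of_ne_zero hn
  rw [taylor_within_apply, Finset.sum_range_succ, Finset.sum_range_succ',
    Finset.sum_eq_zero]
  · simp only [hj, iteratedDeriv_zero]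
    simp
    ring
  · intro j hjn
    rw [hj, h0 _ (by omega) (by simp at hjn; omega)]
    simp

theorem tendsto_sub_div_pow {g : ℝ → ℝ} {x : ℝ} {n : ℕ} (hn : n ≠ 0)
    (hg : ContDiffAt ℝ n g x) (h0 : ∀ j, 1 ≤ j → j < n → iteratedDeriv j g x = 0) :
    Tendsto (fun y => (g y - g x) / (y - x) ^ n) (𝓝[≠] x)
      (𝓝 (iteratedDeriv n g x / n.factorial)) := by
  have h := (isLittleO_sub_iteratedDeriv hn hg h0).tendsto_div_nhds_zero.mono_left
    (nhdsWithin_le_nhds (s := {x}ᶜ))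
  have h2 := h.add_const (iteratedDeriv n g x / n.factorial)
  rw [zero_add] at h2
  refine h2.congr' ?_
  filter_upwards [self_mem_nhdsWithin] with y hy
  have : y - x ≠ 0 := sub_ne_zero.2 hy
  field_simp
  ring

theorem IsLocalMax.iteratedDeriv_two_nonpos {g : ℝ → ℝ} {x : ℝ} (hm : IsLocalMax g x)
    (hg : ContDiffAt ℝ 2 g x) : iteratedDeriv 2 g x ≤ 0 := by
  have h := tendsto_sub_div_pow (n := 2) (by norm_num) hg (by
    intro j h1 h2
    obtain rfl : j = 1 := by omega
    rw [iteratedDeriv_one, hm.deriv_eq_zero])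
  have : iteratedDeriv 2 g x / (2 : ℕ).factorial ≤ 0 := by
    refine le_of_tendsto h ?_
    filter_upwards [hm.filter_mono nhdsWithin_le_nhds] with y hy
    exact div_nonpos_of_nonpos_of_nonneg (by linarith) (sq_nonneg _)
  norm_num at this
  linarith

/-- A nonzero cubic leading term would change sign at `x`: the quotient by `(y - x)^3` is
nonpositive on the right and nonnegative on the left. -/
theorem IsLocalMax.iteratedDeriv_three_eq_zero {g : ℝ → ℝ} {x : ℝ} (hm : IsLocalMax g x)
    (hg : ContDiffAt ℝ 3 g x) (h2 : iteratedDeriv 2 g x = 0) : iteratedDeriv 3 g x = 0 := by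
  have h := tendsto_sub_div_pow (n := 3) (by norm_num) hg (by
    intro j h1 h3
    obtain rfl | rfl : j = 1 ∨ j = 2 := by omega
    · rw [iteratedDeriv_one, hm.deriv_eq_zero]
    · exact h2)
  have h1 : iteratedDeriv 3 g x / (3 : ℕ).factorial ≤ 0 := by
    refine le_of_tendsto (h.mono_left (nhdsWithin_mono x (s := Set.Ioi x) fun y hy => ne_of_gt hy)) ?_
    filter_upwards [hm.filter_mono nhdsWithin_le_nhds, self_mem_nhdsWithin] with y hy hxy
    have : 0 < y - x := sub_pos.2 hxy
    exact div_nonpos_of_nonpos_of_nonneg (by linarith) (by positivity)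
  have h3 : 0 ≤ iteratedDeriv 3 g x / (3 : ℕ).factorial := by
    refine ge_of_tendsto (h.mono_left (nhdsWithin_mono x (s := Set.Iio x) fun y hy => ne_of_lt hy)) ?_
    filter_upwards [hm.filter_mono nhdsWithin_le_nhds, self_mem_nhdsWithin] with y hy hxy
    have : y - x < 0 := sub_neg.2 hxy
    exact div_nonneg_of_nonpos (by linarith) (by
      have : 0 < (x - y) ^ 3 := by have := neg_pos.2 this; rw [neg_sub] at this; positivity
      nlinarith)
  norm_num [Nat.factorial] at h1 h3
  linarith

end

section

/-! ### Points with equal coordinates off the first one -/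

/-- The first coordinate of `xvec (d + 1) s`. -/
noncomputable def headCoord (d : ℕ) (s : ℝ) : ℝ := (1 + d * s) / (d + 1)

/-- The other coordinates of `xvec (d + 1) s`. -/
noncomputable def tailCoord (d : ℕ) (s : ℝ) : ℝ := (1 - s) / (d + 1)

variable {p d : ℕ} {β h : ℝ}

theorem negFreeEnergy_eq (q : ℕ) [NeZero q] (t : Vec q) :
    negFreeEnergy p q β h t = ∑ r, kfun p β (t r) + h * t 0 := by
  simp only [negFreeEnergy, kfun, Finset.sum_sub_distrib, Finset.mul_sum]
  ring

theorem continuous_negFreeEnergy (q : ℕ) [NeZero q] : Continuous (negFreeEnergy p q β h) := by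
  have : negFreeEnergy p q β h = fun t => ∑ r, kfun p β (t r) + h * t 0 :=
    funext fun t => negFreeEnergy_eq q t
  rw [this]
  have := continuous_kfun (p := p) (β := β)
  fun_prop

@[simp] theorem xvec_zero (s : ℝ) : xvec (d + 1) s 0 = headCoord d s := by
  simp [xvec, headCoord]

@[simp] theorem xvec_succ (s : ℝ) (i : Fin d) : xvec (d + 1) s i.succ = tailCoord d s := by
  simp [xvec, tailCoord]

theorem headCoord_add (d : ℕ) (s : ℝ) : headCoord d s + d * tailCoord d s = 1 := by
  unfold headCoord tailCoord
  field_simp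
  ring

theorem headCoord_sub (d : ℕ) (s : ℝ) : headCoord d s - tailCoord d s = s := by
  unfold headCoord tailCoord
  field_simp
  ring

theorem profile_eq (s : ℝ) : profile p (d + 1) β h s =
    kfun p β (headCoord d s) + d * kfun p β (tailCoord d s) + h * headCoord d s := by
  rw [profile, negFreeEnergy_eq, Fin.sum_univ_succ]
  simp

theorem tailCoord_pos {s : ℝ} (hs : s < 1) : 0 < tailCoord d s := by
  have : 0 < 1 - s := sub_pos.2 hs
  unfold tailCoord; positivity

theorem hasDerivAt_headCoord (s : ℝ) : HasDerivAt (headCoord d) (d / (d + 1)) s := by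
  have := (((hasDerivAt_id s).const_mul (d : ℝ)).const_add 1).div_const ((d : ℝ) + 1)
  simpa using! this

theorem hasDerivAt_tailCoord (s : ℝ) : HasDerivAt (tailCoord d) (-1 / (d + 1)) s := by
  have := ((hasDerivAt_id s).const_sub 1).div_const ((d : ℝ) + 1)
  simpa using! this

/-- The parameters at which both coordinates of `xvec (d + 1) s` are positive. -/
def coordDomain (d : ℕ) : Set ℝ := {s | 0 < headCoord d s ∧ 0 < tailCoord d s}

theorem isOpen_coordDomain : IsOpen (coordDomain d) := by
  have h1 : Continuous (headCoord d) := by unfold headCoord; fun_prop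
  have h2 : Continuous (tailCoord d) := by unfold tailCoord; fun_prop
  exact (isOpen_lt continuous_const h1).inter (isOpen_lt continuous_const h2)

theorem mem_coordDomain {s : ℝ} (h0 : 0 ≤ s) (h1 : s < 1) : s ∈ coordDomain d :=
  ⟨by unfold headCoord; positivity, tailCoord_pos h1⟩

theorem deriv_profile {s : ℝ} (hs : s ∈ coordDomain d) :
    deriv (profile p (d + 1) β h) s =
      d / (d + 1) * (kfunD1 p β (headCoord d s) - kfunD1 p β (tailCoord d s) + h) := by
  have e : profile p (d + 1) β h = fun s => kfun p β (headCoord d s) +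
    d * kfun p β (tailCoord d s) + h * headCoord d s := funext profile_eq
  rw [e]
  have h1 := (hasDerivAt_kfun (p := p) (β := β) hs.1).comp s (hasDerivAt_headCoord s)
  have h2 := (hasDerivAt_kfun (p := p) (β := β) hs.2).comp s (hasDerivAt_tailCoord s)
  refine (((h1.add (h2.const_mul (d : ℝ))).add
    ((hasDerivAt_headCoord s).const_mul h)).congr_deriv ?_).deriv
  field_simp
  ring

theorem iteratedDeriv_two_profile (hp : 2 ≤ p) {s : ℝ} (hs : s ∈ coordDomain d) :
    iteratedDeriv 2 (profile p (d + 1) β h) s =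
      d / (d + 1) ^ 2 * (d * kfunD2 p β (headCoord d s) + kfunD2 p β (tailCoord d s)) := by
  rw [iteratedDeriv_succ, iteratedDeriv_one]
  have : deriv (profile p (d + 1) β h) =ᶠ[𝓝 s] fun s =>
      d / (d + 1) * (kfunD1 p β (headCoord d s) - kfunD1 p β (tailCoord d s) + h) := by
    filter_upwards [isOpen_coordDomain.mem_nhds hs] with y hy using deriv_profile hy
  rw [this.deriv_eq]
  have h1 := (hasDerivAt_kfunD1 (β := β) hp hs.1).comp s (hasDerivAt_headCoord s)
  have h2 := (hasDerivAt_kfunD1 (β := β) hp hs.2).comp s (hasDerivAt_tailCoord s)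
  refine ((((h1.sub h2).add_const h).const_mul ((d : ℝ) / (d + 1))).congr_deriv ?_).deriv
  field_simp
  ring

theorem iteratedDeriv_three_profile (hp : 2 ≤ p) {s : ℝ} (hs : s ∈ coordDomain d) :
    iteratedDeriv 3 (profile p (d + 1) β h) s =
      d / (d + 1) ^ 3 * (d ^ 2 * kfunD3 p β (headCoord d s) - kfunD3 p β (tailCoord d s)) := by
  rw [iteratedDeriv_succ]
  have : iteratedDeriv 2 (profile p (d + 1) β h) =ᶠ[𝓝 s] fun s =>
      d / (d + 1) ^ 2 * (d * kfunD2 p β (headCoord d s) + kfunD2 p β (tailCoord d s)) := by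
    filter_upwards [isOpen_coordDomain.mem_nhds hs] with y hy using iteratedDeriv_two_profile hp hy
  rw [this.deriv_eq]
  have h1 := (hasDerivAt_kfunD2 (p := p) (β := β) hs.1).comp s (hasDerivAt_headCoord s)
  have h2 := (hasDerivAt_kfunD2 (p := p) (β := β) hs.2).comp s (hasDerivAt_tailCoord s)
  refine ((((h1.const_mul (d : ℝ)).add h2).const_mul ((d : ℝ) / (d + 1) ^ 2)).congr_deriv ?_).deriv
  field_simp
  ring

theorem contDiffAt_kfun {n : WithTop ℕ∞} {x : ℝ} (hx : 0 < x) : ContDiffAt ℝ n (kfun p β) x := by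
  unfold kfun
  exact (contDiffAt_const.mul (contDiffAt_id.pow p)).sub
    (contDiffAt_id.mul (Real.contDiffAt_log.2 hx.ne'))

theorem contDiffAt_profile {n : WithTop ℕ∞} {s : ℝ} (hs : s ∈ coordDomain d) :
    ContDiffAt ℝ n (profile p (d + 1) β h) s := by
  have e : profile p (d + 1) β h = fun s => kfun p β (headCoord d s) +
    d * kfun p β (tailCoord d s) + h * headCoord d s := funext profile_eq
  rw [e]
  have a1 : ContDiffAt ℝ n (headCoord d) s := by unfold headCoord; fun_prop
  have a2 : ContDiffAt ℝ n (tailCoord d) s := by unfold tailCoord; fun_prop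
  have h1 := ContDiffAt.comp s (contDiffAt_kfun (p := p) (β := β) (n := n) hs.1) a1
  have h2 := ContDiffAt.comp s (contDiffAt_kfun (p := p) (β := β) (n := n) hs.2) a2
  exact (h1.add (contDiffAt_const.mul h2)).add (contDiffAt_const.mul a1)

/-! ### The form of a unique maximizer -/

theorem xvec_mem_probVectors {s : ℝ} (hs : s ∈ coordDomain d) :
    xvec (d + 1) s ∈ probVectors (d + 1) := by
  refine ⟨fun r => ?_, ?_⟩
  · refine Fin.cases ?_ (fun i => ?_) r
    · simpa using hs.1.le
    · simpa using hs.2.le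
  · rw [Fin.sum_univ_succ]
    simp [headCoord_add]

/-- A permutation of the coordinates. -/
noncomputable def permVec {q : ℕ} (σ : Equiv.Perm (Fin q)) (t : Vec q) : Vec q :=
  WithLp.toLp 2 fun r => t (σ r)

theorem permVec_mem {q : ℕ} (σ : Equiv.Perm (Fin q)) {t : Vec q} (ht : t ∈ probVectors q) :
    permVec σ t ∈ probVectors q :=
  ⟨fun r => ht.1 (σ r), by simpa [permVec] using (Equiv.sum_comp σ fun r => t r).trans ht.2⟩

theorem negFreeEnergy_permVec {q : ℕ} [NeZero q] (σ : Equiv.Perm (Fin q)) (t : Vec q) :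
    negFreeEnergy p q β h (permVec σ t) = negFreeEnergy p q β h t + h * (t (σ 0) - t 0) := by
  rw [negFreeEnergy_eq, negFreeEnergy_eq]
  have := Equiv.sum_comp σ fun r => kfun p β (t r)
  simp only [permVec]
  rw [this]
  ring

/-- Moving a small mass `δ` from the first color to each of the others costs energy linear in `δ`,
while the entropy gains `-δ log δ` per color, which is larger. -/
theorem exists_profile_gt_profile_one (hd : 1 ≤ d) (hβ : 0 < β) (hh : 0 ≤ h) :
    ∃ s : ℝ, s ∈ coordDomain d ∧ profile p (d + 1) β h 1 < profile p (d + 1) β h s := by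
  have hd' : (0 : ℝ) < d := by exact_mod_cast hd
  -- The energy loss is at most `(β p + h) d δ`. With `δ ≤ exp (-c)` the entropy gains at least `c d
  -- δ`, so the surplus is at least `d δ`.
  set c := β * p + h + 1 with hc
  have hc0 : 0 < c := by positivity
  set δ := Real.exp (-c) / (d + 1) with hδ
  have hδ0 : 0 < δ := by positivity
  have hδd : δ * (d + 1) < 1 := by
    rw [hδ, div_mul_cancel₀ _ (by positivity)]
    exact Real.exp_lt_one_iff.2 (by linarith)
  have hlog : Real.log δ ≤ -c := by
    rw [hδ, Real.log_div (Real.exp_pos _).ne' (by positivity), Real.log_exp]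
    have := Real.log_nonneg (by linarith : (1 : ℝ) ≤ d + 1)
    linarith
  have h1 : tailCoord d (1 - (d + 1) * δ) = δ := by
    unfold tailCoord; field_simp; ring
  have h2 : headCoord d (1 - (d + 1) * δ) = 1 - d * δ := by
    unfold headCoord; field_simp; ring
  have h3 : tailCoord d 1 = 0 := by simp [tailCoord]
  have h4 : headCoord d 1 = 1 := by unfold headCoord; rw [mul_one, add_comm]; exact div_self (by positivity)
  have h5 : 0 < 1 - d * δ := by nlinarith
  refine ⟨1 - (d + 1) * δ, ⟨by rw [h2]; exact h5, by rw [h1]; exact hδ0⟩, ?_⟩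
  rw [profile_eq, profile_eq, h1, h2, h3, h4]
  have hbern : 1 - p * (d * δ) ≤ (1 - d * δ) ^ p := by
    have := one_add_mul_le_pow (a := -(d * δ)) (by nlinarith) p
    calc _ = 1 + p * (-(d * δ)) := by ring
      _ ≤ _ := this
      _ = _ := by ring
  have hent : (1 - d * δ) * Real.log (1 - d * δ) ≤ 0 :=
    mul_nonpos_of_nonneg_of_nonpos h5.le (Real.log_nonpos h5.le (by nlinarith))
  have hpow : 0 ≤ β * δ ^ p := by positivity
  have hk0 : kfun p β 0 ≤ β * 0 ^ p := by simp [kfun]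
  have hdδ : 0 < d * δ := by positivity
  have h6 : d * (δ * Real.log δ) ≤ d * δ * (-c) := by
    rw [← mul_assoc]; exact mul_le_mul_of_nonneg_left hlog hdδ.le
  have h7 : β * (1 - p * (d * δ)) ≤ β * (1 - d * δ) ^ p := mul_le_mul_of_nonneg_left hbern hβ.le
  simp only [kfun, one_pow, Real.log_one, Real.log_zero]
  -- Here `0 ^ 0 = 1` makes `p = 0` a separate case: empty colors then still contribute `β`.
  rcases Nat.eq_zero_or_pos p with rfl | hp
  · simp only [pow_zero]
    nlinarith
  · rw [zero_pow hp.ne']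
    have : 0 ≤ d * (β * δ ^ p) := by positivity
    rw [hc] at h6
    nlinarith

/-- A permutation that does not lower the first coordinate maps the maximizer to a maximizer, hence
fixes it by uniqueness. Swaps among the other colors make their coordinates equal; the swap with the
first color shows that the first coordinate is at least as large. -/
theorem exists_eq_xvec (hd : 1 ≤ d) (hβ : 0 < β) (hh : 0 ≤ h) {m : Vec (d + 1)}
    (hm : IsGlobalMaximizer p (d + 1) β h m)
    (huniq : ∀ m' : Vec (d + 1), IsGlobalMaximizer p (d + 1) β h m' → m' = m) :
    ∃ s ∈ Set.Ico (0 : ℝ) 1, m = xvec (d + 1) s := by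
  have hd' : (0 : ℝ) < d := by exact_mod_cast hd
  have hperm (σ : Equiv.Perm (Fin (d + 1))) (hσ : m 0 ≤ m (σ 0)) (r : Fin (d + 1)) :
      m (σ r) = m r := by
    have : permVec σ m = m := huniq _ ⟨permVec_mem σ hm.1, fun t ht =>
      (hm.2 t ht).trans (by
        rw [negFreeEnergy_permVec]
        nlinarith)⟩
    exact congrArg (fun v : Vec (d + 1) => v r) this
  set i0 : Fin d := ⟨0, hd⟩
  have htail (i : Fin d) : m i.succ = m i0.succ := by
    have := hperm (Equiv.swap i.succ i0.succ) (by
      rw [Equiv.swap_apply_of_ne_of_ne] <;> exact (Fin.succ_ne_zero _).symm) i0.succ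
    rwa [Equiv.swap_apply_right] at this
  have hle : m i0.succ ≤ m 0 := by
    by_contra! hlt
    have := hperm (Equiv.swap 0 i0.succ) (by rw [Equiv.swap_apply_left]; exact hlt.le) 0
    rw [Equiv.swap_apply_left] at this
    linarith
  have hsum : m 0 + d * m i0.succ = 1 := by
    have := hm.1.2
    rw [Fin.sum_univ_succ] at this
    simpa [htail] using this
  have hmx : m = xvec (d + 1) (m 0 - m i0.succ) := by
    ext r
    have e1 : m i0.succ = tailCoord d (m 0 - m i0.succ) := by
      unfold tailCoord; field_simp; linarith
    refine Fin.cases ?_ (fun i => ?_) r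
    · rw [xvec_zero]
      unfold headCoord; field_simp; linarith
    · rw [xvec_succ, htail, ← e1]
  have h1 : 0 ≤ m i0.succ := hm.1.1 _
  refine ⟨m 0 - m i0.succ, ⟨by linarith, lt_of_le_of_ne (by nlinarith) fun h1' => ?_⟩, hmx⟩
  rw [h1'] at hmx
  obtain ⟨s, hs, hlt⟩ := exists_profile_gt_profile_one (p := p) hd hβ hh
  have := hm.2 _ (xvec_mem_probVectors hs)
  rw [hmx] at this
  exact absurd hlt (not_lt.2 this)

theorem isLocalMax_profile {s : ℝ} (hs : s ∈ coordDomain d)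
    (hm : IsGlobalMaximizer p (d + 1) β h (xvec (d + 1) s)) :
    IsLocalMax (profile p (d + 1) β h) s := by
  filter_upwards [isOpen_coordDomain.mem_nhds hs] with y hy
  exact hm.2 _ (xvec_mem_probVectors hy)

/-- If `k''` were nonnegative at the tail coordinate, it would be so at the larger head coordinate
too, so `f'' ≥ 0`. Maximality then forces `f'' = f''' = 0`, the two curvatures agree, and the
coordinates coincide; but there `f'''` is a positive multiple of `(d^2 - 1) k'''`, which is positive
for `d ≥ 2`. -/
theorem kfunD2_tailCoord_neg (hp : 2 ≤ p) (hd : 2 ≤ d) (hβ : 0 < β) {s : ℝ} (h0 : 0 ≤ s)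
    (h1 : s < 1) (hm : IsGlobalMaximizer p (d + 1) β h (xvec (d + 1) s)) :
    kfunD2 p β (tailCoord d s) < 0 := by
  by_contra! hb
  have hs : s ∈ coordDomain d := mem_coordDomain h0 h1
  have hd' : (2 : ℝ) ≤ d := by exact_mod_cast hd
  have hmax := isLocalMax_profile hs hm
  have hle : tailCoord d s ≤ headCoord d s := by linarith [headCoord_sub d s]
  have ha : kfunD2 p β (tailCoord d s) ≤ kfunD2 p β (headCoord d s) :=
    (strictMonoOn_kfunD2 hp hβ).monotoneOn hs.2 hs.1 hle
  have h2 := IsLocalMax.iteratedDeriv_two_nonpos hmax (contDiffAt_profile hs)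
  have h2' : iteratedDeriv 2 (profile p (d + 1) β h) s = 0 := by
    refine le_antisymm h2 ?_
    rw [iteratedDeriv_two_profile hp hs]
    have : 0 ≤ kfunD2 p β (headCoord d s) := hb.trans ha
    positivity
  have h3 := IsLocalMax.iteratedDeriv_three_eq_zero hmax (contDiffAt_profile hs) h2'
  rw [iteratedDeriv_two_profile hp hs, mul_eq_zero, or_iff_right (by positivity)] at h2'
  have heq : headCoord d s = tailCoord d s :=
    (strictMonoOn_kfunD2 hp hβ).injOn hs.1 hs.2 (by nlinarith)
  rw [iteratedDeriv_three_profile hp hs, mul_eq_zero, or_iff_right (by positivity), heq] at h3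
  have := kfunD3_pos hp hβ hs.2
  have h4 : 1 < (d : ℝ) ^ 2 := by nlinarith
  nlinarith [mul_pos (sub_pos.2 h4) this]

/-- Up to positive factors the form is `d k''(head) + k''(tail)` along `u` and `k''(tail)` across
it. The first is nonpositive by maximality and the second is negative (the complement being trivial
for `d = 1`), so a nonzero null vector must lie along `u`. -/
theorem iteratedDeriv_two_profile_eq_zero (hp : 2 ≤ p) (hd : 1 ≤ d) (hβ : 0 < β) {s : ℝ}
    (h0 : 0 ≤ s) (h1 : s < 1) (hm : IsGlobalMaximizer p (d + 1) β h (xvec (d + 1) s))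
    {t : Vec (d + 1)} (ht : t ∈ zeroSum (d + 1)) (ht0 : t ≠ 0)
    (hQ : quadForm p (d + 1) β (xvec (d + 1) s) t = 0) :
    iteratedDeriv 2 (profile p (d + 1) β h) s = 0 := by
  have hs : s ∈ coordDomain d := mem_coordDomain h0 h1
  have hd' : (1 : ℝ) ≤ d := by exact_mod_cast hd
  have h2 := IsLocalMax.iteratedDeriv_two_nonpos (isLocalMax_profile hs hm) (contDiffAt_profile hs)
  rw [iteratedDeriv_two_profile hp hs] at h2 ⊢
  have hpos : 0 < (d : ℝ) / (d + 1) ^ 2 := by positivity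
  set a := kfunD2 p β (headCoord d s) with hadef
  set b := kfunD2 p β (tailCoord d s) with hbdef
  have hab : d * a + b ≤ 0 := by
    by_contra! hcon
    exact absurd h2 (not_le.2 (mul_pos hpos hcon))
  have hQ' : a * t 0 ^ 2 + b * ∑ i : Fin d, t i.succ ^ 2 = 0 := by
    rw [← hQ, quadForm, Fin.sum_univ_succ, Finset.mul_sum]
    simp [hadef, hbdef, kfunD2]
  have hsum : t 0 + ∑ i : Fin d, t i.succ = 0 := by
    have : ∑ r, t r = 0 := ht
    rwa [Fin.sum_univ_succ] at this
  -- The numbers `t i.succ + t 0 / d` are the coordinates left after subtracting the component along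
  -- `u`.
  have hvar : ∑ i : Fin d, (t i.succ + t 0 / d) ^ 2 = ∑ i : Fin d, t i.succ ^ 2 - t 0 ^ 2 / d := by
    simp only [add_sq, Finset.sum_add_distrib, ← Finset.sum_mul, ← Finset.mul_sum]
    simp only [Finset.sum_const, Finset.card_univ, Fintype.card_fin, nsmul_eq_mul]
    rw [show ∑ i : Fin d, t i.succ = - t 0 by linarith]
    field_simp
    ring
  have hvar0 : 0 ≤ ∑ i : Fin d, (t i.succ + t 0 / d) ^ 2 :=
    Finset.sum_nonneg fun i _ => sq_nonneg _
  have hkey : (d * a + b) * (t 0 ^ 2 / d) + b * ∑ i : Fin d, (t i.succ + t 0 / d) ^ 2 = 0 := by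
    rw [hvar, ← hQ']
    field_simp
    ring
  have hbv : ∑ i : Fin d, (t i.succ + t 0 / d) ^ 2 = 0 := by
    rcases hd.eq_or_lt with h1' | hd2
    · subst h1'
      simp at hsum ⊢
      linarith
    · have hb : b < 0 := kfunD2_tailCoord_neg hp hd2 hβ h0 h1 hm
      by_contra hne
      have : 0 < ∑ i : Fin d, (t i.succ + t 0 / d) ^ 2 := lt_of_le_of_ne hvar0 (Ne.symm hne)
      have h1 : (d * a + b) * (t 0 ^ 2 / d) ≤ 0 :=
        mul_nonpos_of_nonpos_of_nonneg hab (by positivity)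
      nlinarith
  rw [hbv, mul_zero, add_zero, mul_eq_zero] at hkey
  rcases hkey with hk | hk
  · rw [hk, mul_zero]
  · exfalso
    apply ht0
    have ht00 : t 0 = 0 := by
      rcases div_eq_zero_iff.1 hk with hk | hk
      · exact pow_eq_zero_iff (by norm_num) |>.1 hk
      · linarith
    rw [Finset.sum_eq_zero_iff_of_nonneg fun i _ => sq_nonneg _] at hbv
    ext r
    refine Fin.cases ?_ (fun i => ?_) r
    · simpa using ht00
    · have := pow_eq_zero_iff (by norm_num) |>.1 (hbv i (Finset.mem_univ i))
      simpa [ht00] using this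

end

section

variable {p d : ℕ} {β h : ℝ}

/-! ### Expansion of the free energy around the maximizer -/

/-- The point `x_s + a • u + (0, w)`. -/
noncomputable def shiftVec (d : ℕ) (s a : ℝ) (w : Fin d → ℝ) : Vec (d + 1) :=
  WithLp.toLp 2 (Fin.cons (headCoord d s - d * a) fun i => tailCoord d s + a + w i)

@[simp] theorem shiftVec_zero (s a : ℝ) (w : Fin d → ℝ) :
    shiftVec d s a w 0 = headCoord d s - d * a := rfl

@[simp] theorem shiftVec_succ (s a : ℝ) (w : Fin d → ℝ) (i : Fin d) :
    shiftVec d s a w i.succ = tailCoord d s + a + w i := rfl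

/-- Since `x_s + a u = x_{s - (d+1) a}`, the displacement along `u` is absorbed exactly by the
profile; it otherwise enters only as a shift of the base point of the terms in `w`. -/
theorem negFreeEnergy_shiftVec (s a : ℝ) (w : Fin d → ℝ) :
    negFreeEnergy p (d + 1) β h (shiftVec d s a w) = profile p (d + 1) β h (s - (d + 1) * a) +
      ∑ i, (kfun p β (tailCoord d s + a + w i) - kfun p β (tailCoord d s + a)) := by
  have e1 : headCoord d (s - (d + 1) * a) = headCoord d s - d * a := by
    unfold headCoord; field_simp; ring
  have e2 : tailCoord d (s - (d + 1) * a) = tailCoord d s + a := by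
    unfold tailCoord; field_simp; ring
  rw [profile_eq, e1, e2, negFreeEnergy_eq, Fin.sum_univ_succ]
  simp
  ring

/-- The remainder of the first order expansion of `kfun`. -/
noncomputable def kfunRem (p : ℕ) (β x y : ℝ) : ℝ :=
  kfun p β (x + y) - kfun p β x - kfunD1 p β x * y

theorem sum_kfunRem {w : Fin d → ℝ} (hw : ∑ i, w i = 0) (x : ℝ) :
    ∑ i, (kfun p β (x + w i) - kfun p β x) = ∑ i, kfunRem p β x (w i) := by
  simp only [kfunRem, Finset.sum_sub_distrib, ← Finset.mul_sum, hw]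
  ring

/-- Positivity is placed inside the conclusion so that `ξ` can be chosen along a whole sequence,
although positivity holds only eventually. -/
theorem exists_kfunRem_eq (hp : 2 ≤ p) (x y : ℝ) : ∃ ξ, |ξ - x| ≤ |y| ∧
    (0 < x → 0 < x + y → kfunRem p β x y = kfunD2 p β ξ / 2 * y ^ 2) := by
  by_cases hpos : 0 < x ∧ 0 < x + y
  swap
  · exact ⟨x, by simp, fun h1 h2 => absurd ⟨h1, h2⟩ hpos⟩
  rcases eq_or_ne y 0 with rfl | hy
  · exact ⟨x, by simp, fun _ _ => by simp [kfunRem]⟩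
  have hne : x ≠ x + y := by simpa using hy
  have hsub : ∀ z ∈ Set.uIcc x (x + y), 0 < z := fun z hz =>
    lt_of_lt_of_le (lt_min hpos.1 hpos.2) hz.1
  have hcd : ContDiffOn ℝ (1 + 1) (kfun p β) (Set.uIcc x (x + y)) := fun z hz =>
    (contDiffAt_kfun (hsub z hz)).contDiffWithinAt
  obtain ⟨ξ, hξ, hξe⟩ := taylor_mean_remainder_lagrange_iteratedDeriv (n := 1) hne (by exact_mod_cast hcd)
  have hξ' : ξ ∈ Set.uIcc x (x + y) := Set.Ioo_subset_Icc_self hξ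
  refine ⟨ξ, ?_, fun _ _ => ?_⟩
  · have := Set.abs_sub_left_of_mem_uIcc hξ'
    simpa using this
  · rw [taylorWithinEval_succ, taylor_within_zero_eval, iteratedDerivWithin_one,
      (hasDerivAt_kfun hpos.1).hasDerivWithinAt.derivWithin
        (uniqueDiffOn_uIcc hne x Set.left_mem_uIcc),
      iteratedDeriv_two_kfun hp (hsub ξ hξ')] at hξe
    simp at hξe
    rw [kfunRem]
    linear_combination hξe

theorem exists_sum_kfunRem_le (hp : 2 ≤ p) {x : ℝ} (hx : 0 < x)
    (hneg : 2 ≤ d → kfunD2 p β x < 0) :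
    ∃ c > 0, ∃ δ > 0, ∀ (a : ℝ) (w : Fin d → ℝ), ∑ i, w i = 0 → |a| < δ → (∀ i, |w i| < δ) →
      ∑ i, kfunRem p β (x + a) (w i) ≤ -c * ∑ i, w i ^ 2 := by
  rcases le_or_gt d 1 with hd | hd
  -- With at most one tail coordinate, zero sum means `w = 0`, and no curvature is needed.
  · refine ⟨1, one_pos, 1, one_pos, fun a w hw _ _ => ?_⟩
    have h0 : ∀ i, w i = 0 := fun i => by
      have : Subsingleton (Fin d) := Fin.subsingleton_iff_le_one.2 hd
      rw [← hw, Finset.sum_eq_single i (fun j _ hj => absurd (Subsingleton.elim j i) hj) (by simp)]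
    simp [h0, kfunRem]
  · have hn := hneg hd
    have hc : ∀ᶠ ξ in 𝓝 x, kfunD2 p β ξ < kfunD2 p β x / 2 :=
      (hasDerivAt_kfunD2 hx).continuousAt.eventually_lt continuousAt_const (by linarith)
    obtain ⟨δ, hδ, hball⟩ := Metric.eventually_nhds_iff.1 (hc.and (lt_mem_nhds hx))
    refine ⟨-kfunD2 p β x / 4, by linarith, δ / 2, by positivity, fun a w _ ha hw => ?_⟩
    rw [Finset.mul_sum]
    refine Finset.sum_le_sum fun i _ => ?_
    obtain ⟨ξ, hξ, hξe⟩ := exists_kfunRem_eq (β := β) hp (x + a) (w i)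
    have h1 : 0 < x + a := (hball (y := x + a) (by
      rw [Real.dist_eq]; simpa using ha.trans (by linarith))).2
    have h2 : 0 < x + a + w i := (hball (y := x + a + w i) (by
      rw [Real.dist_eq, show x + a + w i - x = a + w i by ring]
      linarith [abs_add_le a (w i), hw i])).2
    have h3 := (hball (y := ξ) (by
      rw [Real.dist_eq, show ξ - x = (ξ - (x + a)) + a by ring]
      linarith [abs_add_le (ξ - (x + a)) a, hw i])).1
    rw [hξe h1 h2]
    nlinarith [sq_nonneg (w i)]

/-- The derivatives of the profile up to third order vanish and the fourth is negative. -/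
structure IsQuarticMax (p d : ℕ) (β h s : ℝ) : Prop where
  mem : s ∈ coordDomain d
  isMax : IsGlobalMaximizer p (d + 1) β h (xvec (d + 1) s)
  unique : ∀ m' : Vec (d + 1), IsGlobalMaximizer p (d + 1) β h m' → m' = xvec (d + 1) s
  tail_neg : 2 ≤ d → kfunD2 p β (tailCoord d s) < 0
  deriv_eq_zero : ∀ j, 1 ≤ j → j < 4 → iteratedDeriv j (profile p (d + 1) β h) s = 0
  deriv_four_neg : iteratedDeriv 4 (profile p (d + 1) β h) s < 0

theorem IsQuarticMax.of_special (hp : 2 ≤ p) (hd : 1 ≤ d) (hI : IsTypeISpecial p (d + 1) β h) :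
    ∃ s ∈ Set.Ico (0 : ℝ) 1, IsQuarticMax p d β h s := by
  obtain ⟨⟨hβ, hh, m, hm, hu, t, ht, ht0, hQ⟩, h4⟩ := hI
  obtain ⟨s, hs, rfl⟩ := exists_eq_xvec hd hβ hh hm hu
  have hmem : s ∈ coordDomain d := mem_coordDomain hs.1 hs.2
  have h2 := iteratedDeriv_two_profile_eq_zero hp hd hβ hs.1 hs.2 hm ht ht0 hQ
  have hmax := isLocalMax_profile hmem hm
  refine ⟨s, hs, hmem, hm, hu, fun hd2 => kfunD2_tailCoord_neg hp hd2 hβ hs.1 hs.2 hm,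
    fun j hj1 hj4 => ?_, h4 s hs hm⟩
  obtain rfl | rfl | rfl : j = 1 ∨ j = 2 ∨ j = 3 := by omega
  · rw [iteratedDeriv_one, hmax.deriv_eq_zero]
  · exact h2
  · exact IsLocalMax.iteratedDeriv_three_eq_zero hmax (contDiffAt_profile hmem) h2

namespace IsQuarticMax

variable {s : ℝ}

/-! ### Upper bounds on the free energy around a quartic maximum. -/

theorem isLittleO_profile (H : IsQuarticMax p d β h s) :
    (fun y => profile p (d + 1) β h y - profile p (d + 1) β h s -
    iteratedDeriv 4 (profile p (d + 1) β h) s / 24 * (y - s) ^ 4) =o[𝓝 s] fun y => (y - s) ^ 4 := by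
  have := isLittleO_sub_iteratedDeriv (n := 4) (by norm_num) (contDiffAt_profile H.mem)
    H.deriv_eq_zero
  simpa [Nat.factorial] using this

theorem exists_profile_le (H : IsQuarticMax p d β h s) : ∃ c > 0, ∃ δ > 0, ∀ a : ℝ, |a| < δ →
    profile p (d + 1) β h (s - (d + 1) * a) - profile p (d + 1) β h s ≤ -c * a ^ 4 := by
  have h4 := H.deriv_four_neg
  set F := iteratedDeriv 4 (profile p (d + 1) β h) s with hF
  have hev := (H.isLittleO_profile).def (c := -F / 48) (by linarith)
  obtain ⟨δ, hδ, hb⟩ := Metric.eventually_nhds_iff.1 hev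
  have hd1 : (0 : ℝ) < d + 1 := by positivity
  refine ⟨-F / 48 * (d + 1) ^ 4, mul_pos (by linarith) (by positivity), δ / (d + 1), by positivity,
    fun a ha => ?_⟩
  have h1 := hb (y := s - (d + 1) * a) (by
    rw [Real.dist_eq, sub_sub_cancel_left, abs_neg, abs_mul, abs_of_pos hd1]
    rwa [lt_div_iff₀ hd1, mul_comm] at ha)
  rw [sub_sub_cancel_left, Real.norm_eq_abs, Real.norm_eq_abs, Even.neg_pow (by decide),
    abs_of_nonneg (by positivity : 0 ≤ ((d + 1) * a) ^ 4), mul_pow] at h1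
  have := (abs_le.1 h1).2
  rw [← hF] at this
  nlinarith

/-- Off a ball around the maximizer the simplex is compact, so `H` attains its maximum there;
uniqueness makes that value strictly smaller. -/
theorem exists_gap (H : IsQuarticMax p d β h s) {ε : ℝ} (hε : 0 < ε) : ∃ η > 0, ∀ x ∈ probVectors (d + 1),
    ε ≤ dist x (xvec (d + 1) s) →
      negFreeEnergy p (d + 1) β h x ≤ negFreeEnergy p (d + 1) β h (xvec (d + 1) s) - η := by
  have hcoord (r : Fin (d + 1)) : Continuous fun x : Vec (d + 1) => x r := by fun_prop
  have hclosed : IsClosed (probVectors (d + 1)) := by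
    have : probVectors (d + 1) = (⋂ r, {x : Vec (d + 1) | 0 ≤ x r}) ∩ {x | ∑ r, x r = 1} := by
      ext x; simp [probVectors]
    rw [this]
    exact (isClosed_iInter fun r => isClosed_le continuous_const (hcoord r)).inter
      (isClosed_eq (continuous_finsetSum _ fun r _ => hcoord r) continuous_const)
  have hbdd : Bornology.IsBounded (probVectors (d + 1)) := by
    refine (Metric.isBounded_closedBall (x := (0 : Vec (d + 1))) (r := 1)).subset fun x hx => ?_
    rw [mem_closedBall_zero_iff, EuclideanSpace.norm_eq, Real.sqrt_le_one,
      ← hx.2]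
    refine Finset.sum_le_sum fun r _ => ?_
    have h1 : x r ≤ 1 := hx.2 ▸ Finset.single_le_sum (fun j _ => hx.1 j) (Finset.mem_univ r)
    rw [Real.norm_eq_abs, sq_abs]
    nlinarith [hx.1 r]
  set K := probVectors (d + 1) ∩ {x | ε ≤ dist x (xvec (d + 1) s)} with hK
  have hKc : IsCompact K :=
    (Metric.isCompact_of_isClosed_isBounded hclosed hbdd).inter_right
      (isClosed_le continuous_const (by fun_prop))
  rcases K.eq_empty_or_nonempty with hE | hne
  · exact ⟨1, one_pos, fun x hx hd => absurd (show x ∈ K from ⟨hx, hd⟩) (by simp [hE])⟩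
  · obtain ⟨y, hy, hymax⟩ := hKc.exists_isMaxOn hne (continuous_negFreeEnergy _).continuousOn
      (f := negFreeEnergy p (d + 1) β h)
    have hlt : negFreeEnergy p (d + 1) β h y < negFreeEnergy p (d + 1) β h (xvec (d + 1) s) := by
      refine lt_of_le_of_ne (H.isMax.2 y hy.1) fun heq => ?_
      have := H.unique y ⟨hy.1, fun t ht => heq ▸ H.isMax.2 t ht⟩
      have h2 := hy.2
      rw [Set.mem_ofPred_eq, this, dist_self] at h2
      linarith
    refine ⟨_, sub_pos.2 hlt, fun x hx hd => ?_⟩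
    have : negFreeEnergy p (d + 1) β h x ≤ negFreeEnergy p (d + 1) β h y := hymax ⟨hx, hd⟩
    linarith

/-- Near the maximizer the quartic bound along `u` and the quadratic bound across it add up.
Elsewhere the gap `η` suffices, because `|a| ≤ 1` and `|w i| ≤ 2` on the simplex keep the right-hand
quantity below `1 + 4 d`. Validity on the whole simplex is what domination requires. -/
theorem exists_negFreeEnergy_le (H : IsQuarticMax p d β h s) (hp : 2 ≤ p) (hd : 1 ≤ d) :
    ∃ c > 0, ∀ (a : ℝ) (w : Fin d → ℝ),
    ∑ i, w i = 0 → shiftVec d s a w ∈ probVectors (d + 1) →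
      negFreeEnergy p (d + 1) β h (shiftVec d s a w) -
        negFreeEnergy p (d + 1) β h (xvec (d + 1) s) ≤ -c * (a ^ 4 + ∑ i, w i ^ 2) := by
  have hd' : (1 : ℝ) ≤ d := by exact_mod_cast hd
  obtain ⟨c1, hc1, δ1, hδ1, h1⟩ := H.exists_profile_le
  obtain ⟨c2, hc2, δ2, hδ2, h2⟩ := exists_sum_kfunRem_le hp H.mem.2 H.tail_neg
  obtain ⟨η, hη, h3⟩ := H.exists_gap (ε := min δ1 δ2 / 2) (by positivity)
  have hM : (0 : ℝ) < 1 + 4 * d := by positivity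
  refine ⟨min (min c1 c2) (η / (1 + 4 * d)), by positivity, fun a w hw hx => ?_⟩
  have hsq : 0 ≤ ∑ i, w i ^ 2 := Finset.sum_nonneg fun i _ => sq_nonneg _
  have hdiff0 : |d * a| = |shiftVec d s a w 0 - xvec (d + 1) s 0| := by
    rw [shiftVec_zero, xvec_zero, sub_sub_cancel_left, abs_neg]
  have hdiff (i : Fin d) : |a + w i| = |shiftVec d s a w i.succ - xvec (d + 1) s i.succ| := by
    rw [shiftVec_succ, xvec_succ]; ring_nf
  have ha' : |a| ≤ |d * a| := by
    rw [abs_mul, abs_of_pos (by linarith : (0 : ℝ) < d)]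
    nlinarith [abs_nonneg a]
  have hw' (i : Fin d) : |w i| ≤ |a + w i| + |a| := by
    have := abs_sub (a + w i) a
    rwa [add_sub_cancel_left] at this
  by_cases hdist : min δ1 δ2 / 2 ≤ dist (shiftVec d s a w) (xvec (d + 1) s)
  · have hm := H.isMax.1
    have hle (y : Vec (d + 1)) (hy : y ∈ probVectors (d + 1)) (r : Fin (d + 1)) : y r ≤ 1 :=
      hy.2 ▸ Finset.single_le_sum (fun j _ => hy.1 j) (Finset.mem_univ r)
    have hcoord (r : Fin (d + 1)) : |shiftVec d s a w r - xvec (d + 1) s r| ≤ 1 := by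
      rw [abs_le]
      constructor <;> linarith [hx.1 r, hm.1 r, hle _ hx r, hle _ hm r]
    have ha1 : |a| ≤ 1 := ha'.trans (hdiff0 ▸ hcoord 0)
    have hw1 (i : Fin d) : |w i| ≤ 2 := by
      have := hw' i
      have := hcoord i.succ
      rw [← hdiff] at this
      linarith
    have hB : a ^ 4 + ∑ i, w i ^ 2 ≤ 1 + 4 * d := by
      have e1 : a ^ 4 ≤ 1 := by
        have := pow_le_one₀ (n := 4) (abs_nonneg a) ha1
        rwa [Even.pow_abs (by decide)] at this
      have e2 : ∑ i, w i ^ 2 ≤ ∑ _i : Fin d, (4 : ℝ) :=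
        Finset.sum_le_sum fun i _ => by
          have := abs_le.1 (hw1 i)
          nlinarith
      simp at e2
      linarith
    have := h3 _ hx hdist
    have hmin : min (min c1 c2) (η / (1 + 4 * d)) * (a ^ 4 + ∑ i, w i ^ 2) ≤ η := by
      calc _ ≤ η / (1 + 4 * d) * (1 + 4 * d) := by
            gcongr
            exact min_le_right _ _
        _ = η := by field_simp
    linarith
  · push Not at hdist
    have hcoord (r : Fin (d + 1)) :
        |shiftVec d s a w r - xvec (d + 1) s r| ≤ dist (shiftVec d s a w) (xvec (d + 1) s) := by
      have := PiLp.norm_apply_le (shiftVec d s a w - xvec (d + 1) s) r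
      rwa [← dist_eq_norm] at this
    have hm1 := min_le_left δ1 δ2
    have hm2 := min_le_right δ1 δ2
    have ha1 : |a| ≤ dist (shiftVec d s a w) (xvec (d + 1) s) := ha'.trans (hdiff0 ▸ hcoord 0)
    have hw1 (i : Fin d) : |w i| < δ2 := by
      have := hw' i
      have := hcoord i.succ
      rw [← hdiff] at this
      linarith
    have e1 := h1 a (by linarith [abs_nonneg a])
    have e2 := h2 a w hw (by linarith [abs_nonneg a]) hw1
    rw [negFreeEnergy_shiftVec, sum_kfunRem hw]
    have hprof : negFreeEnergy p (d + 1) β h (xvec (d + 1) s) = profile p (d + 1) β h s := rfl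
    rw [hprof]
    have k1 : min (min c1 c2) (η / (1 + 4 * d)) * a ^ 4 ≤ c1 * a ^ 4 := by
      gcongr
      exact (min_le_left _ _).trans (min_le_left _ _)
    have k2 : min (min c1 c2) (η / (1 + 4 * d)) * ∑ i, w i ^ 2 ≤ c2 * ∑ i, w i ^ 2 := by
      gcongr
      exact (min_le_left _ _).trans (min_le_right _ _)
    linarith

end IsQuarticMax

/-! ### Limit of the free energy on the fluctuation scales. -/

theorem tendsto_kfunRem (hp : 2 ≤ p) {x₀ v : ℝ} (hx₀ : 0 < x₀) {x y r : ℕ → ℝ}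
    (hx : Tendsto x atTop (𝓝 x₀)) (hy : Tendsto y atTop (𝓝 0))
    (hv : Tendsto (fun n => r n * y n ^ 2) atTop (𝓝 v)) :
    Tendsto (fun n => r n * kfunRem p β (x n) (y n)) atTop (𝓝 (kfunD2 p β x₀ / 2 * v)) := by
  choose ξ hξ hξe using fun n => exists_kfunRem_eq (β := β) hp (x n) (y n)
  have hξt : Tendsto ξ atTop (𝓝 x₀) := by
    have h0 : Tendsto (fun n => ξ n - x n) atTop (𝓝 0) :=
      squeeze_zero_norm hξ (by simpa using hy.abs)
    simpa using h0.add hx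
  have hxy : Tendsto (fun n => x n + y n) atTop (𝓝 x₀) := by simpa using hx.add hy
  have h2 := ((hasDerivAt_kfunD2 (p := p) (β := β) hx₀).continuousAt.tendsto.comp hξt).div_const 2
  refine (h2.mul hv).congr' ?_
  filter_upwards [hx.eventually (lt_mem_nhds hx₀), hxy.eventually (lt_mem_nhds hx₀)] with n h1 h3
  rw [hξe n h1 h3]
  simp only [Function.comp]
  ring

theorem tendsto_rpow_neg_zero {e : ℝ} (he : e < 0) :
    Tendsto (fun N : ℕ => (N : ℝ) ^ e) atTop (𝓝 0) := by
  have := (tendsto_rpow_neg_atTop (neg_pos.2 he)).comp tendsto_natCast_atTop_atTop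
  simpa [Function.comp_def] using this

/-- The factor `N` is balanced by `(N^(-1/4))^4` in the Taylor expansion of the profile and by
`(N^(-1/2))^2` in the remainders of `k`, whose base points still tend to the tail coordinate. -/
theorem IsQuarticMax.tendsto_negFreeEnergy (hp : 2 ≤ p) {s : ℝ} (H : IsQuarticMax p d β h s)
    {t : ℕ → ℝ} {w : ℕ → Fin d → ℝ} {t₀ : ℝ} {w₀ : Fin d → ℝ} (ht : Tendsto t atTop (𝓝 t₀))
    (hw : ∀ i, Tendsto (fun N => w N i) atTop (𝓝 (w₀ i))) (hw0 : ∀ N, ∑ i, w N i = 0) :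
    Tendsto (fun N : ℕ => N * (negFreeEnergy p (d + 1) β h
        (shiftVec d s ((N : ℝ) ^ (-(1 / 4) : ℝ) * t N) fun i => (N : ℝ) ^ (-(1 / 2) : ℝ) * w N i) -
        negFreeEnergy p (d + 1) β h (xvec (d + 1) s))) atTop
      (𝓝 (t₀ ^ 4 / 24 * (d + 1) ^ 4 * iteratedDeriv 4 (profile p (d + 1) β h) s +
        kfunD2 p β (tailCoord d s) / 2 * ∑ i, w₀ i ^ 2)) := by
  have hq : Tendsto (fun N : ℕ => (N : ℝ) ^ (-(1 / 4) : ℝ)) atTop (𝓝 0) :=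
    tendsto_rpow_neg_zero (by norm_num)
  have hh : Tendsto (fun N : ℕ => (N : ℝ) ^ (-(1 / 2) : ℝ)) atTop (𝓝 0) :=
    tendsto_rpow_neg_zero (by norm_num)
  have ha : Tendsto (fun N : ℕ => (N : ℝ) ^ (-(1 / 4) : ℝ) * t N) atTop (𝓝 0) := by
    simpa using hq.mul ht
  have hq4 {N : ℕ} (hN : 0 < N) : (N : ℝ) * ((N : ℝ) ^ (-(1 / 4) : ℝ)) ^ 4 = 1 := by
    have hN' : (0 : ℝ) < N := by exact_mod_cast hN
    rw [← Real.rpow_natCast, ← Real.rpow_mul hN'.le]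
    norm_num
    rw [Real.rpow_neg_one]
    exact mul_inv_cancel₀ hN'.ne'
  have hh2 {N : ℕ} (hN : 0 < N) : (N : ℝ) * ((N : ℝ) ^ (-(1 / 2) : ℝ)) ^ 2 = 1 := by
    have hN' : (0 : ℝ) < N := by exact_mod_cast hN
    rw [← Real.rpow_natCast, ← Real.rpow_mul hN'.le]
    norm_num
    rw [Real.rpow_neg_one]
    exact mul_inv_cancel₀ hN'.ne'
  set F := iteratedDeriv 4 (profile p (d + 1) β h) s with hF
  -- the quartic part
  have hy : Tendsto (fun N : ℕ => s - (d + 1) * ((N : ℝ) ^ (-(1 / 4) : ℝ) * t N)) atTop (𝓝 s) := by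
    simpa using (ha.const_mul ((d : ℝ) + 1)).const_sub s
  have hN4 : Tendsto (fun N : ℕ =>
      (N : ℝ) * (s - (d + 1) * ((N : ℝ) ^ (-(1 / 4) : ℝ) * t N) - s) ^ 4) atTop
      (𝓝 ((d + 1) ^ 4 * t₀ ^ 4)) := by
    refine ((ht.pow 4).const_mul (((d : ℝ) + 1) ^ 4)).congr' ?_
    filter_upwards [eventually_gt_atTop 0] with N hN
    linear_combination (-((d : ℝ) + 1) ^ 4 * t N ^ 4) * hq4 hN
  have hO := H.isLittleO_profile.comp_tendsto hy
  have hquart : Tendsto (fun N : ℕ => N * (profile p (d + 1) β h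
      (s - (d + 1) * ((N : ℝ) ^ (-(1 / 4) : ℝ) * t N)) - profile p (d + 1) β h s)) atTop
      (𝓝 (F / 24 * ((d + 1) ^ 4 * t₀ ^ 4))) := by
    have hsmall : Tendsto (fun N : ℕ => (N : ℝ) * (profile p (d + 1) β h
        (s - (d + 1) * ((N : ℝ) ^ (-(1 / 4) : ℝ) * t N)) - profile p (d + 1) β h s -
        F / 24 * (s - (d + 1) * ((N : ℝ) ^ (-(1 / 4) : ℝ) * t N) - s) ^ 4)) atTop (𝓝 0) := by
      have h1 := (Asymptotics.isBigO_refl (fun N : ℕ => (N : ℝ)) atTop).mul_isLittleO hO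
      have h2 := h1.trans_isBigO (hN4.isBigO_one ℝ)
      simpa using! h2.tendsto_div_nhds_zero
    have := hsmall.add (hN4.const_mul (F / 24))
    rw [zero_add] at this
    refine this.congr fun N => ?_
    ring
  -- the quadratic part
  have hquad (i : Fin d) : Tendsto (fun N : ℕ => (N : ℝ) * kfunRem p β
      (tailCoord d s + (N : ℝ) ^ (-(1 / 4) : ℝ) * t N) ((N : ℝ) ^ (-(1 / 2) : ℝ) * w N i)) atTop
      (𝓝 (kfunD2 p β (tailCoord d s) / 2 * w₀ i ^ 2)) := by
    refine tendsto_kfunRem hp H.mem.2 (by simpa using ha.const_add (tailCoord d s))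
      (by simpa using hh.mul (hw i)) (((hw i).pow 2).congr' ?_)
    filter_upwards [eventually_gt_atTop 0] with N hN
    linear_combination (-w N i ^ 2) * hh2 hN
  have hsum := hquart.add (tendsto_finsetSum Finset.univ fun i _ => hquad i)
  convert hsum using 2 with N
  · rw [negFreeEnergy_shiftVec, sum_kfunRem (by rw [← Finset.mul_sum, hw0, mul_zero]),
      ← Finset.mul_sum]
    have hprof : negFreeEnergy p (d + 1) β h (xvec (d + 1) s) = profile p (d + 1) β h s := rfl
    rw [hprof]
    ring
  · rw [Finset.mul_sum]
    ring

/-! ### The linear perturbation -/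

/-- The derivative of the free energy in the direction of a perturbation of the parameters. -/
noncomputable def perturbation (p d : ℕ) (βbar hbar : ℝ) (x : Vec (d + 1)) : ℝ :=
  βbar * ∑ r, x r ^ p + hbar * x 0

/-- Factoring `x^p - x₀^p` through the geometric sum gives the derivative as a limit without
dividing by `x - x₀`. -/
theorem tendsto_mul_pow_sub {x c : ℕ → ℝ} {x₀ v : ℝ} (hx : Tendsto x atTop (𝓝 x₀))
    (hv : Tendsto (fun n => c n * (x n - x₀)) atTop (𝓝 v)) :
    Tendsto (fun n => c n * (x n ^ p - x₀ ^ p)) atTop (𝓝 (p * x₀ ^ (p - 1) * v)) := by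
  have h1 : Tendsto (fun n => ∑ i ∈ Finset.range p, x n ^ i * x₀ ^ (p - 1 - i)) atTop
      (𝓝 (p * x₀ ^ (p - 1))) := by
    rw [← geom_sum₂_self]
    exact tendsto_finsetSum _ fun i _ => (hx.pow i).mul_const _
  refine (h1.mul hv).congr fun n => ?_
  rw [← geom_sum₂_mul]
  ring

/-- Multiplied by `N^(1/4)`, the displacement along `u` is of order one and the one across it of
order `N^(-1/4)`. Hence the perturbation tilts `T` but not `V`. -/
theorem tendsto_perturbation (βbar hbar : ℝ) (s : ℝ)
    {t : ℕ → ℝ} {w : ℕ → Fin d → ℝ} {t₀ : ℝ} {w₀ : Fin d → ℝ} (ht : Tendsto t atTop (𝓝 t₀))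
    (hw : ∀ i, Tendsto (fun N => w N i) atTop (𝓝 (w₀ i))) :
    Tendsto (fun N : ℕ => (N : ℝ) ^ (1 / 4 : ℝ) * (perturbation p d βbar hbar
        (shiftVec d s ((N : ℝ) ^ (-(1 / 4) : ℝ) * t N) fun i => (N : ℝ) ^ (-(1 / 2) : ℝ) * w N i) -
        perturbation p d βbar hbar (xvec (d + 1) s))) atTop
      (𝓝 ((βbar * p * (∑ r, xvec (d + 1) s r ^ (p - 1) * uvec (d + 1) r) +
        hbar * (1 - (d + 1 : ℕ))) * t₀)) := by
  have hq : Tendsto (fun N : ℕ => (N : ℝ) ^ (-(1 / 4) : ℝ)) atTop (𝓝 0) :=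
    tendsto_rpow_neg_zero (by norm_num)
  have hh : Tendsto (fun N : ℕ => (N : ℝ) ^ (-(1 / 2) : ℝ)) atTop (𝓝 0) :=
    tendsto_rpow_neg_zero (by norm_num)
  have ha : Tendsto (fun N : ℕ => (N : ℝ) ^ (-(1 / 4) : ℝ) * t N) atTop (𝓝 0) := by
    simpa using hq.mul ht
  have hb (i : Fin d) : Tendsto (fun N : ℕ => (N : ℝ) ^ (-(1 / 2) : ℝ) * w N i) atTop (𝓝 0) := by
    simpa using hh.mul (hw i)
  set x : ℕ → Vec (d + 1) := fun N => shiftVec d s ((N : ℝ) ^ (-(1 / 4) : ℝ) * t N)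
    fun i => (N : ℝ) ^ (-(1 / 2) : ℝ) * w N i with hxdef
  have hmul {N : ℕ} (hN : 0 < N) : (N : ℝ) ^ (1 / 4 : ℝ) * (N : ℝ) ^ (-(1 / 4) : ℝ) = 1 := by
    have hN' : (0 : ℝ) < N := by exact_mod_cast hN
    rw [← Real.rpow_add hN']; norm_num
  have hmul2 {N : ℕ} (hN : 0 < N) :
      (N : ℝ) ^ (1 / 4 : ℝ) * (N : ℝ) ^ (-(1 / 2) : ℝ) = (N : ℝ) ^ (-(1 / 4) : ℝ) := by
    have hN' : (0 : ℝ) < N := by exact_mod_cast hN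
    rw [← Real.rpow_add hN']; norm_num
  have hx (r : Fin (d + 1)) : Tendsto (fun N => x N r) atTop (𝓝 (xvec (d + 1) s r)) := by
    refine Fin.cases ?_ (fun i => ?_) r
    · simpa [hxdef] using (ha.const_mul (d : ℝ)).const_sub (headCoord d s)
    · simpa [hxdef] using (ha.const_add (tailCoord d s)).add (hb i)
  have hv (r : Fin (d + 1)) : Tendsto (fun N : ℕ => (N : ℝ) ^ (1 / 4 : ℝ) *
      (x N r - xvec (d + 1) s r)) atTop (𝓝 (uvec (d + 1) r * t₀)) := by
    refine Fin.cases ?_ (fun i => ?_) r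
    · refine (ht.const_mul (uvec (d + 1) 0)).congr' ?_
      filter_upwards [eventually_gt_atTop 0] with N hN
      simp only [hxdef, shiftVec_zero, xvec_zero, uvec, if_true]
      push_cast
      linear_combination (d * t N) * hmul hN
    · have h1 : Tendsto (fun N : ℕ => t N + (N : ℝ) ^ (-(1 / 4) : ℝ) * w N i) atTop
          (𝓝 (uvec (d + 1) i.succ * t₀)) := by
        have e : uvec (d + 1) i.succ * t₀ = t₀ + 0 * w₀ i := by simp [uvec]
        rw [e]
        exact ht.add (hq.mul (hw i))
      refine h1.congr' ?_
      filter_upwards [eventually_gt_atTop 0] with N hN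
      simp only [hxdef, shiftVec_succ, xvec_succ]
      linear_combination (-t N) * hmul hN - w N i * hmul2 hN
  have h1 := (tendsto_finsetSum Finset.univ fun r _ =>
    tendsto_mul_pow_sub (p := p) (hx r) (hv r)).const_mul βbar
  have h2 := (hv 0).const_mul hbar
  convert h1.add h2 using 2 with N
  · simp only [perturbation, ← Finset.mul_sum, Finset.sum_sub_distrib]
    ring
  · have e0 : uvec (d + 1) 0 = 1 - ((d + 1 : ℕ) : ℝ) := by simp [uvec]
    rw [e0, add_mul]
    congr 1
    · simp only [Finset.mul_sum, Finset.sum_mul]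
      exact Finset.sum_congr rfl fun r _ => by ring
    · ring

theorem abs_perturbation_sub_le (βbar hbar : ℝ) {s a : ℝ} {w : Fin d → ℝ}
    (hs : s ∈ coordDomain d) (hx : shiftVec d s a w ∈ probVectors (d + 1)) :
    |perturbation p d βbar hbar (shiftVec d s a w) -
      perturbation p d βbar hbar (xvec (d + 1) s)| ≤
      (|βbar| * p + |hbar|) * (2 * d * |a| + ∑ i, |w i|) := by
  have hm := xvec_mem_probVectors hs
  have hle (y : Vec (d + 1)) (hy : y ∈ probVectors (d + 1)) (r : Fin (d + 1)) : |y r| ≤ 1 := by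
    rw [abs_of_nonneg (hy.1 r), ← hy.2]
    exact Finset.single_le_sum (fun j _ => hy.1 j) (Finset.mem_univ r)
  set x := shiftVec d s a w with hxdef
  have hpow (r : Fin (d + 1)) : |x r ^ p - xvec (d + 1) s r ^ p| ≤ p * |x r - xvec (d + 1) s r| := by
    refine (abs_pow_sub_pow_le _ _ _).trans ?_
    have : max |x r| |xvec (d + 1) s r| ^ (p - 1) ≤ 1 :=
      pow_le_one₀ (le_max_of_le_left (abs_nonneg _)) (max_le (hle _ hx r) (hle _ hm r))
    calc _ ≤ |x r - xvec (d + 1) s r| * p * 1 := by gcongr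
      _ = _ := by ring
  have hd0 : |x 0 - xvec (d + 1) s 0| = d * |a| := by
    rw [hxdef, shiftVec_zero, xvec_zero, sub_sub_cancel_left, abs_neg, abs_mul, Nat.abs_cast]
  have hsum : ∑ r, |x r - xvec (d + 1) s r| ≤ 2 * d * |a| + ∑ i, |w i| := by
    rw [Fin.sum_univ_succ, hd0]
    have : ∑ i : Fin d, |x i.succ - xvec (d + 1) s i.succ| ≤ ∑ i : Fin d, (|a| + |w i|) :=
      Finset.sum_le_sum fun i _ => by
        rw [hxdef, shiftVec_succ, xvec_succ, add_assoc, add_sub_cancel_left]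
        exact abs_add_le _ _
    rw [Finset.sum_add_distrib] at this
    simp only [Finset.sum_const, Finset.card_univ, Fintype.card_fin, nsmul_eq_mul] at this
    linarith
  have hhead : |x 0 - xvec (d + 1) s 0| ≤ ∑ r, |x r - xvec (d + 1) s r| :=
    Finset.single_le_sum (f := fun r => |x r - xvec (d + 1) s r|) (fun j _ => abs_nonneg _)
      (Finset.mem_univ 0)
  have e : perturbation p d βbar hbar x - perturbation p d βbar hbar (xvec (d + 1) s) =
      βbar * ∑ r, (x r ^ p - xvec (d + 1) s r ^ p) + hbar * (x 0 - xvec (d + 1) s 0) := by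
    simp only [perturbation, Finset.sum_sub_distrib]; ring
  rw [e]
  calc _ ≤ |βbar * ∑ r, (x r ^ p - xvec (d + 1) s r ^ p)| + |hbar * (x 0 - xvec (d + 1) s 0)| :=
        abs_add_le _ _
    _ ≤ |βbar| * (p * ∑ r, |x r - xvec (d + 1) s r|) +
        |hbar| * ∑ r, |x r - xvec (d + 1) s r| := by
        rw [abs_mul, abs_mul]
        gcongr
        rw [Finset.mul_sum]
        exact (Finset.abs_sum_le_sum_abs _ _).trans (Finset.sum_le_sum fun r _ => hpow r)
    _ = (|βbar| * p + |hbar|) * ∑ r, |x r - xvec (d + 1) s r| := by ring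
    _ ≤ _ := by gcongr

end

section

/-! ### The correction in Stirling's formula -/

/-- The quotient of `n!` by `(n / e) ^ n`. -/
noncomputable def stirlingQuot (n : ℕ) : ℝ := n.factorial / (n / Real.exp 1) ^ n

theorem stirlingQuot_eq {n : ℕ} (hn : n ≠ 0) :
    stirlingQuot n = √2 * Stirling.stirlingSeq n * √n := by
  have hn' : (0 : ℝ) < n := by positivity
  rw [stirlingQuot, Stirling.stirlingSeq, Real.sqrt_mul (by norm_num)]
  field_simp

theorem sqrt_le_stirlingQuot (n : ℕ) : √n ≤ stirlingQuot n := by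
  rcases eq_or_ne n 0 with rfl | hn
  · simp [stirlingQuot]
  · rw [stirlingQuot_eq hn]
    have h1 := Stirling.sqrt_pi_le_stirlingSeq hn
    have h2 : 1 ≤ √Real.pi := Real.one_le_sqrt.2 (by linarith [Real.two_le_pi])
    have h3 : 1 ≤ √(2 : ℝ) := Real.one_le_sqrt.2 (by norm_num)
    have : 1 ≤ √2 * Stirling.stirlingSeq n := one_le_mul_of_one_le_of_one_le h3 (h2.trans h1)
    nlinarith [Real.sqrt_nonneg (n : ℝ)]

/-- For `n = 0` the value is `1`, by `0 ^ 0 = 1`; this covers colors that do not occur. -/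
theorem one_le_stirlingQuot (n : ℕ) : 1 ≤ stirlingQuot n := by
  rcases eq_or_ne n 0 with rfl | hn
  · simp [stirlingQuot]
  · refine le_trans (Real.one_le_sqrt.2 ?_) (sqrt_le_stirlingQuot n)
    exact_mod_cast Nat.one_le_iff_ne_zero.2 hn

theorem stirlingQuot_le {n : ℕ} (hn : n ≠ 0) : stirlingQuot n ≤ Real.exp 1 * √n := by
  obtain ⟨k, rfl⟩ := Nat.exists_eq_succ_of_ne_zero hn
  rw [stirlingQuot_eq hn]
  have h := Stirling.stirlingSeq'_antitone (Nat.zero_le k)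
  simp only [Function.comp, Nat.succ_eq_add_one, zero_add, Stirling.stirlingSeq_one] at h
  have : √2 * Stirling.stirlingSeq (k + 1) ≤ Real.exp 1 := by
    calc _ ≤ √2 * (Real.exp 1 / √2) := by gcongr
      _ = _ := by field_simp
  gcongr

theorem tendsto_stirlingQuot_div_sqrt :
    Tendsto (fun n : ℕ => stirlingQuot n / √n) atTop (𝓝 (√2 * √Real.pi)) := by
  refine (Stirling.tendsto_stirlingSeq_sqrt_pi.const_mul √2).congr' ?_
  filter_upwards [eventually_ne_atTop 0] with n hn
  have : (0 : ℝ) < n := by positivity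
  rw [stirlingQuot_eq hn]
  field_simp

/-! ### Counting configurations -/

/-- The numbers of sites of the different colors. -/
def countVec {q N : ℕ} (X : Fin N → Fin q) (r : Fin q) : ℕ := (Finset.univ.filter (X · = r)).card

theorem sum_countVec {q N : ℕ} (X : Fin N → Fin q) : ∑ r, countVec X r = N := by
  have := Finset.card_eq_sum_card_fiberwise (f := X) (s := Finset.univ) (t := Finset.univ)
    (fun _ _ => Finset.mem_coe.2 (Finset.mem_univ _))
  simpa [countVec] using this.symm

theorem magnetization_eq {q N : ℕ} (X : Fin N → Fin q) (r : Fin q) :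
    magnetization q N X r = countVec X r / N := by
  simp [magnetization, countVec, div_eq_inv_mul]

theorem countVec_cons {q N : ℕ} (r : Fin q) (Y : Fin N → Fin q) (r' : Fin q) :
    countVec (Fin.cons r Y : Fin (N + 1) → Fin q) r' = countVec Y r' + if r = r' then 1 else 0 := by
  simp only [countVec, Finset.card_filter, Fin.sum_univ_succ, Fin.cons_zero, Fin.cons_succ]
  ring

/-- Induction on the color `r` of the first site: removing that site lowers `n r` by one, so each
`r` contributes `n r * N!`, including `0` when `n r = 0`. Summing over `r` gives `(N + 1)!`. -/
theorem card_countVec_mul_prod_factorial {q : ℕ} (N : ℕ) (n : Fin q → ℕ) (hn : ∑ r, n r = N) :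
    (Finset.univ.filter fun X : Fin N → Fin q => countVec X = n).card * ∏ r, (n r).factorial =
      N.factorial := by
  induction N generalizing n with
  | zero =>
    have h0 : n = 0 := funext fun r => (Finset.sum_eq_zero_iff.1 hn) r (Finset.mem_univ r)
    subst h0
    have : (Finset.univ.filter fun X : Fin 0 → Fin q => countVec X = 0) = Finset.univ := by
      ext X; simp [countVec, funext_iff]
    rw [this]
    simp
  | succ N ih =>
    have hstep (r : Fin q) : (Finset.univ.filter fun Y : Fin N → Fin q =>
        countVec (Fin.cons r Y : Fin (N + 1) → Fin q) = n).card * ∏ r, (n r).factorial =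
          n r * N.factorial := by
      rcases Nat.eq_zero_or_pos (n r) with h0 | hpos
      · rw [h0, zero_mul, Finset.filter_false_of_mem, Finset.card_empty, zero_mul]
        intro Y _ hY
        have := congrFun hY r
        rw [countVec_cons, h0] at this
        simp at this
      · set n' := Function.update n r (n r - 1) with hn'
        have hfil : (Finset.univ.filter fun Y : Fin N → Fin q =>
            countVec (Fin.cons r Y : Fin (N + 1) → Fin q) = n) =
            Finset.univ.filter fun Y : Fin N → Fin q => countVec Y = n' := by
          ext Y
          simp only [Finset.mem_filter, Finset.mem_univ, true_and, funext_iff, countVec_cons, hn']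
          refine forall_congr' fun r' => ?_
          by_cases hr : r' = r
          · subst hr
            simp only [if_true, Function.update_self]
            omega
          · rw [Function.update_of_ne hr, if_neg (Ne.symm hr), add_zero]
        have hsum : ∑ r, n' r = N := by
          have h1 := Finset.add_sum_erase Finset.univ n (Finset.mem_univ r)
          have h2 := Finset.add_sum_erase Finset.univ n' (Finset.mem_univ r)
          have h3 : ∑ x ∈ Finset.univ.erase r, n' x = ∑ x ∈ Finset.univ.erase r, n x :=
            Finset.sum_congr rfl fun x hx => by
              rw [hn', Function.update_of_ne (Finset.ne_of_mem_erase hx)]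
          have h4 : n' r = n r - 1 := by rw [hn', Function.update_self]
          omega
        have hprod : ∏ r, (n r).factorial = n r * ∏ r, (n' r).factorial := by
          rw [← Finset.mul_prod_erase _ _ (Finset.mem_univ r),
            ← Finset.mul_prod_erase Finset.univ (fun r => (n' r).factorial) (Finset.mem_univ r)]
          have h3 : ∏ x ∈ Finset.univ.erase r, (n' x).factorial =
              ∏ x ∈ Finset.univ.erase r, (n x).factorial :=
            Finset.prod_congr rfl fun x hx => by
              rw [hn', Function.update_of_ne (Finset.ne_of_mem_erase hx)]
          rw [h3, hn', Function.update_self, ← mul_assoc, Nat.mul_factorial_pred hpos.ne']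
        rw [hfil, hprod, ← ih n' hsum]
        ring
    have hsplit : (Finset.univ.filter fun X : Fin (N + 1) → Fin q => countVec X = n).card =
        ∑ r, (Finset.univ.filter fun Y : Fin N → Fin q =>
          countVec (Fin.cons r Y : Fin (N + 1) → Fin q) = n).card := by
      simp only [Finset.card_filter]
      rw [← Fintype.sum_prod_type']
      exact (Fintype.sum_equiv (Fin.consEquiv fun _ => Fin q) _ _ fun x => rfl).symm
    rw [hsplit, Finset.sum_mul, Finset.sum_congr rfl fun r _ => hstep r, ← Finset.sum_mul, hn,
      Nat.factorial_succ]

theorem exists_countVec_eq {q N : ℕ} (n : Fin q → ℕ) (hn : ∑ r, n r = N) :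
    ∃ X : Fin N → Fin q, countVec X = n := by
  have h := card_countVec_mul_prod_factorial N n hn
  have hne : (Finset.univ.filter fun X : Fin N → Fin q => countVec X = n).card ≠ 0 := by
    intro h0
    rw [h0, zero_mul] at h
    exact (Nat.factorial_pos N).ne h
  obtain ⟨X, hX⟩ := Finset.card_ne_zero.1 hne
  exact ⟨X, (Finset.mem_filter.1 hX).2⟩

/-- After writing `n! = stirlingQuot n * (n / e)^n` in the multinomial coefficient, the powers of `N
/ e` cancel because the counts add up to `N`. What remains is the exponential of the entropy, which
completes the energy in the weight to `N H`. -/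
theorem card_mul_weight {p q : ℕ} [NeZero q] {β h : ℝ} {N : ℕ} (hN : N ≠ 0) (X : Fin N → Fin q) :
    (Finset.univ.filter fun Y : Fin N → Fin q => countVec Y = countVec X).card *
      weight p q β h N X = (stirlingQuot N / ∏ r, stirlingQuot (countVec X r)) *
        Real.exp (N * negFreeEnergy p q β h (magnetization q N X)) := by
  have hN' : (0 : ℝ) < N := by positivity
  set n := countVec X with hn
  have hcard : ((Finset.univ.filter fun Y : Fin N → Fin q => countVec Y = n).card : ℝ) *
      ∏ r, ((n r).factorial : ℝ) = N.factorial := by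
    exact_mod_cast card_countVec_mul_prod_factorial N n (sum_countVec X)
  have hfac (k : ℕ) : (k.factorial : ℝ) = stirlingQuot k * (k / Real.exp 1) ^ k := by
    rcases eq_or_ne k 0 with rfl | hk
    · simp [stirlingQuot]
    · have : (0 : ℝ) < k := by positivity
      rw [stirlingQuot]
      field_simp
  have hx (r : Fin q) : (magnetization q N X r) = n r / N := magnetization_eq X r
  have hpow (r : Fin q) : ((n r : ℝ) / Real.exp 1) ^ n r =
      (N / Real.exp 1) ^ n r * Real.exp (N * ((n r / N) * Real.log (n r / N))) := by
    rcases eq_or_ne (n r) 0 with h0 | h0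
    · simp [h0]
    · have h1 : (0 : ℝ) < n r := by positivity
      have e : (N : ℝ) * ((n r / N) * Real.log (n r / N)) = n r * Real.log (n r / N) := by
        field_simp
      rw [e, Real.exp_nat_mul, Real.exp_log (by positivity), ← mul_pow]
      congr 1
      field_simp
  have hprod : ∏ r, ((n r).factorial : ℝ) = (∏ r, stirlingQuot (n r)) * ((N / Real.exp 1) ^ N *
      Real.exp (N * ∑ r, (n r / N : ℝ) * Real.log (n r / N))) := by
    simp only [hfac, hpow, Finset.prod_mul_distrib]
    rw [Finset.prod_pow_eq_pow_sum, sum_countVec, Finset.mul_sum, Real.exp_sum]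
  have hpos : 0 < ∏ r, stirlingQuot (n r) :=
    Finset.prod_pos fun r _ => zero_lt_one.trans_le (one_le_stirlingQuot _)
  rw [hprod, hfac N] at hcard
  have hA : (0 : ℝ) < (N / Real.exp 1) ^ N := by positivity
  have hE := Real.exp_pos ((N : ℝ) * ∑ r, (n r / N : ℝ) * Real.log (n r / N))
  set E := Real.exp ((N : ℝ) * ∑ r, (n r / N : ℝ) * Real.log (n r / N)) with hEdef
  set c := ((Finset.univ.filter fun Y : Fin N → Fin q => countVec Y = n).card : ℝ)
  have hc : c * E = stirlingQuot N / ∏ r, stirlingQuot (n r) := by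
    rw [eq_div_iff hpos.ne']
    have : (N / Real.exp 1) ^ N * (c * E * ∏ r, stirlingQuot (n r)) =
        (N / Real.exp 1) ^ N * stirlingQuot N := by linear_combination hcard
    exact mul_left_cancel₀ hA.ne' this
  have hw : weight p q β h N X =
      E * Real.exp (N * negFreeEnergy p q β h (magnetization q N X)) := by
    rw [hEdef, ← Real.exp_add, weight, negFreeEnergy]
    simp only [hx]
    congr 1
    ring
  rw [hw, ← mul_assoc, hc]

end

section

/-! ### The rescaled lattice -/

variable {d N : ℕ} {s : ℝ}

/-- The arithmetic mean of a vector. -/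
noncomputable def mean (z : Fin d → ℝ) : ℝ := (∑ i, z i) / d

theorem mean_add (y z : Fin d → ℝ) : mean (fun i => y i + z i) = mean y + mean z := by
  simp only [mean, Finset.sum_add_distrib, add_div]

theorem mean_const_mul (c : ℝ) (z : Fin d → ℝ) : mean (fun i => c * z i) = c * mean z := by
  simp only [mean, ← Finset.mul_sum, mul_div_assoc]

theorem mean_const (hd : 1 ≤ d) (c : ℝ) : mean (fun _ : Fin d => c) = c := by
  have : (0 : ℝ) < d := by exact_mod_cast hd
  simp [mean]
  field_simp

theorem sum_sub_mean (hd : 1 ≤ d) (z : Fin d → ℝ) : ∑ i, (z i - mean z) = 0 := by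
  have : (0 : ℝ) < d := by exact_mod_cast hd
  simp [mean]
  field_simp
  ring

theorem mean_sub_mean (hd : 1 ≤ d) (z : Fin d → ℝ) : mean (fun i => z i - mean z) = 0 := by
  rw [mean, sum_sub_mean hd, zero_div]

theorem mean_mem_Icc (hd : 1 ≤ d) {z : Fin d → ℝ} {a b : ℝ} (hz : ∀ i, z i ∈ Set.Icc a b) :
    mean z ∈ Set.Icc a b := by
  have hd' : (0 : ℝ) < d := by exact_mod_cast hd
  have h1 := Finset.card_nsmul_le_sum Finset.univ z a fun i _ => (hz i).1
  have h2 := Finset.sum_le_card_nsmul Finset.univ z b fun i _ => (hz i).2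
  simp only [Finset.card_univ, Fintype.card_fin, nsmul_eq_mul] at h1 h2
  exact ⟨by rw [mean, le_div_iff₀ hd']; linarith, by rw [mean, div_le_iff₀ hd']; linarith⟩

@[fun_prop]
theorem continuous_mean : Continuous (mean : (Fin d → ℝ) → ℝ) := by
  unfold mean; fun_prop

/-- The coordinate of the fluctuation along `u`, on the scale `N ^ (-1/4)`. -/
noncomputable def tCoord (d : ℕ) (s : ℝ) (X : Fin N → Fin (d + 1)) : ℝ :=
  (N : ℝ) ^ (1 / 4 : ℝ) *
    mean fun i : Fin d => magnetization (d + 1) N X i.succ - tailCoord d s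

/-- The coordinates of the fluctuation orthogonal to `u`, on the scale `N ^ (-1/2)`. -/
noncomputable def wCoord (d : ℕ) (s : ℝ) (X : Fin N → Fin (d + 1)) (i : Fin d) : ℝ :=
  (N : ℝ) ^ (1 / 2 : ℝ) * (magnetization (d + 1) N X i.succ - tailCoord d s -
    mean fun i : Fin d => magnetization (d + 1) N X i.succ - tailCoord d s)

theorem sum_wCoord (hd : 1 ≤ d) (X : Fin N → Fin (d + 1)) : ∑ i, wCoord d s X i = 0 := by
  simp only [wCoord]
  rw [← Finset.mul_sum, sum_sub_mean hd, mul_zero]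

theorem sum_magnetization {q : ℕ} (hN : N ≠ 0) (X : Fin N → Fin q) :
    ∑ r, magnetization q N X r = 1 := by
  have hN' : (0 : ℝ) < N := by positivity
  simp only [magnetization_eq, ← Finset.sum_div]
  rw [div_eq_one_iff_eq hN'.ne']
  exact_mod_cast sum_countVec X

theorem magnetization_mem {q : ℕ} (hN : N ≠ 0) (X : Fin N → Fin q) :
    magnetization q N X ∈ probVectors q :=
  ⟨fun r => by rw [magnetization_eq]; positivity, sum_magnetization hN X⟩

theorem magnetization_eq_shiftVec (hd : 1 ≤ d) (hN : N ≠ 0) (X : Fin N → Fin (d + 1)) :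
    magnetization (d + 1) N X = shiftVec d s ((N : ℝ) ^ (-(1 / 4) : ℝ) * tCoord d s X)
      fun i => (N : ℝ) ^ (-(1 / 2) : ℝ) * wCoord d s X i := by
  have hN' : (0 : ℝ) < N := by positivity
  have hd' : (0 : ℝ) < d := by exact_mod_cast hd
  have e1 : (N : ℝ) ^ (-(1 / 4) : ℝ) * (N : ℝ) ^ (1 / 4 : ℝ) = 1 := by
    rw [← Real.rpow_add hN']; norm_num
  have e2 : (N : ℝ) ^ (-(1 / 2) : ℝ) * (N : ℝ) ^ (1 / 2 : ℝ) = 1 := by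
    rw [← Real.rpow_add hN']; norm_num
  ext r
  refine Fin.cases ?_ (fun i => ?_) r
  · rw [shiftVec_zero, tCoord, ← mul_assoc ((N : ℝ) ^ (-(1 / 4) : ℝ)), e1, one_mul, mean, mul_div_cancel₀ _ hd'.ne',
      Finset.sum_sub_distrib]
    have := sum_magnetization hN X
    rw [Fin.sum_univ_succ] at this
    simp only [Finset.sum_const, Finset.card_univ, Fintype.card_fin, nsmul_eq_mul]
    linarith [headCoord_add d s]
  · rw [shiftVec_succ, tCoord, wCoord, ← mul_assoc, ← mul_assoc, e1, e2]
    ring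

/-- The affine map from the rescaled variables to the numbers of sites of the colors. -/
noncomputable def scaleMap (d : ℕ) (s : ℝ) (N : ℕ) (z : Fin d → ℝ) (i : Fin d) : ℝ :=
  N * tailCoord d s + ((N : ℝ) ^ (3 / 4 : ℝ) * mean z + (N : ℝ) ^ (1 / 2 : ℝ) * (z i - mean z))

/-- The rescaled variables that are rounded down to the configuration. -/
def cell (d : ℕ) (s : ℝ) (X : Fin N → Fin (d + 1)) : Set (Fin d → ℝ) :=
  {z | ∀ i : Fin d, ⌊scaleMap d s N z i⌋ = (countVec X i.succ : ℤ)}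

theorem measurableSet_cell (X : Fin N → Fin (d + 1)) : MeasurableSet (cell d s X) := by
  have h (i : Fin d) : Measurable fun z => ⌊scaleMap d s N z i⌋ := by
    have : Continuous fun z => scaleMap d s N z i := by unfold scaleMap; fun_prop
    exact this.measurable.floor
  simp only [cell, Set.ofPred_forall]
  exact MeasurableSet.iInter fun i => h i (measurableSet_singleton _)

/-- The linear part of `scaleMap`. -/
noncomputable def scaleLin (d N : ℕ) : (Fin d → ℝ) →ₗ[ℝ] (Fin d → ℝ) where
  toFun z i := (N : ℝ) ^ (3 / 4 : ℝ) * mean z + (N : ℝ) ^ (1 / 2 : ℝ) * (z i - mean z)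
  map_add' y z := by
    ext i
    have : mean (y + z) = mean y + mean z := mean_add y z
    simp only [this, Pi.add_apply]
    ring
  map_smul' c z := by
    ext i
    have : mean (c • z) = c * mean z := mean_const_mul c z
    simp only [this, Pi.smul_apply, smul_eq_mul, RingHom.id_apply]
    ring

theorem det_scaleLin_ne_zero (hd : 1 ≤ d) (hN : N ≠ 0) : LinearMap.det (scaleLin d N) ≠ 0 := by
  have hN' : (0 : ℝ) < N := by positivity
  have hinj : Function.Injective (scaleLin d N) := by
    rw [injective_iff_map_eq_zero]
    intro z hz
    have hz' (i : Fin d) : (N : ℝ) ^ (3 / 4 : ℝ) * mean z +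
        (N : ℝ) ^ (1 / 2 : ℝ) * (z i - mean z) = 0 := congrFun hz i
    have hm : mean z = 0 := by
      have : mean (fun i => (N : ℝ) ^ (3 / 4 : ℝ) * mean z +
          (N : ℝ) ^ (1 / 2 : ℝ) * (z i - mean z)) = 0 := by
        simp only [hz', mean_const hd]
      rw [mean_add, mean_const hd, mean_const_mul, mean_sub_mean hd, mul_zero, add_zero,
        mul_eq_zero] at this
      exact this.resolve_left (by positivity)
    ext i
    have := hz' i
    rw [hm, mul_zero, zero_add, sub_zero, mul_eq_zero] at this
    exact this.resolve_left (by positivity)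
  have := (LinearEquiv.ofInjectiveEndo (scaleLin d N) hinj).isUnit_det'
  exact this.ne_zero

/-- A cell is the preimage of a unit cube under an injective affine map, so its volume is the same
for all configurations. -/
theorem volume_cell (hd : 1 ≤ d) (hN : N ≠ 0) (X : Fin N → Fin (d + 1)) :
    volume (cell d s X) = ENNReal.ofReal |(LinearMap.det (scaleLin d N))⁻¹| := by
  have : cell d s X = scaleLin d N ⁻¹' (Set.univ.pi fun i : Fin d =>
      Set.Ico (countVec X i.succ - N * tailCoord d s) (countVec X i.succ - N * tailCoord d s + 1)) := by
    ext z
    simp only [cell, Set.mem_ofPred_eq, Set.mem_preimage, Set.mem_univ_pi, Int.floor_eq_iff]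
    refine forall_congr' fun i => ?_
    rw [Set.mem_Ico]
    simp only [scaleMap, scaleLin, LinearMap.coe_mk, AddHom.coe_mk, Int.cast_natCast]
    constructor <;> rintro ⟨h1, h2⟩ <;> constructor <;> linarith
  rw [this, Measure.addHaar_preimage_linearMap _ (det_scaleLin_ne_zero hd hN), Real.volume_pi_Ico]
  simp

/-- Configurations with equal counts share a cell, so the integrand carries multiplicities. The
constant `K` cancels in expectations because it does not depend on `G`. -/
theorem exists_sum_eq_integral (hd : 1 ≤ d) (hN : N ≠ 0) (s : ℝ) :
    ∃ K : ℝ, 0 < K ∧ ∀ G : (Fin N → Fin (d + 1)) → ℝ,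
      ∫ z, ∑ X, (cell d s X).indicator (fun _ => G X) z = K * ∑ X, G X := by
  refine ⟨|(LinearMap.det (scaleLin d N))⁻¹|,
    abs_pos.2 (inv_ne_zero (det_scaleLin_ne_zero hd hN)), fun G => ?_⟩
  rw [integral_finsetSum, Finset.mul_sum]
  · refine Finset.sum_congr rfl fun X _ => ?_
    rw [integral_indicator_const _ (measurableSet_cell X), Measure.real, volume_cell hd hN,
      ENNReal.toReal_ofReal (abs_nonneg _), smul_eq_mul]
  · intro X _
    rw [integrable_indicator_iff (measurableSet_cell X)]
    exact integrableOn_const (by rw [volume_cell hd hN]; exact ENNReal.ofReal_ne_top)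

/-- The rounding changes the rescaled variables by at most `N ^ (-1/2)`. -/
theorem abs_coord_sub_le (hd : 1 ≤ d) (hN : N ≠ 0) {X : Fin N → Fin (d + 1)} {z : Fin d → ℝ}
    (hz : z ∈ cell d s X) : |tCoord d s X - mean z| ≤ (N : ℝ) ^ (-(1 / 2) : ℝ) ∧
      ∀ i, |wCoord d s X i - (z i - mean z)| ≤ (N : ℝ) ^ (-(1 / 2) : ℝ) := by
  have hN' : (0 : ℝ) < N := by positivity
  set e : Fin d → ℝ := fun i => countVec X i.succ - scaleMap d s N z i with he
  have heI (i : Fin d) : e i ∈ Set.Icc (-1 : ℝ) 0 := by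
    have := Int.floor_eq_iff.1 (hz i)
    push_cast at this
    exact ⟨by simp only [he]; linarith, by simp only [he]; linarith⟩
  have heM := mean_mem_Icc hd heI
  have p1 : (N : ℝ) ^ (1 / 4 : ℝ) * (N : ℝ) ^ (3 / 4 : ℝ) = N := by
    rw [← Real.rpow_add hN']; norm_num
  have p2 : (N : ℝ) ^ (1 / 2 : ℝ) * (N : ℝ) ^ (1 / 2 : ℝ) = N := by
    rw [← Real.rpow_add hN']; norm_num
  have p3 : (N : ℝ) ^ (1 / 2 : ℝ) / N = (N : ℝ) ^ (-(1 / 2) : ℝ) := by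
    rw [← Real.rpow_sub_one hN'.ne']; norm_num
  -- The mean moves only by `N^(-3/4)`; the weaker common bound is enough.
  have p4 : (N : ℝ) ^ (1 / 4 : ℝ) / N ≤ (N : ℝ) ^ (-(1 / 2) : ℝ) := by
    rw [← p3]
    have h1 : (1 : ℝ) ≤ N := by exact_mod_cast Nat.one_le_iff_ne_zero.2 hN
    gcongr
    norm_num
  have hx (i : Fin d) : magnetization (d + 1) N X i.succ - tailCoord d s =
      (N : ℝ) ^ (3 / 4 : ℝ) / N * mean z + ((N : ℝ) ^ (1 / 2 : ℝ) / N * (z i - mean z) +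
        (N : ℝ)⁻¹ * e i) := by
    rw [magnetization_eq]
    simp only [he, scaleMap]
    field_simp
    ring
  have hmean : mean (fun i : Fin d => magnetization (d + 1) N X i.succ - tailCoord d s) =
      (N : ℝ) ^ (3 / 4 : ℝ) / N * mean z + (N : ℝ)⁻¹ * mean e := by
    simp only [hx]
    rw [mean_add, mean_const hd, mean_add, mean_const_mul, mean_const_mul, mean_sub_mean hd]
    ring
  constructor
  · have : tCoord d s X - mean z = (N : ℝ) ^ (1 / 4 : ℝ) / N * mean e := by
      rw [tCoord, hmean]
      field_simp
      linear_combination mean z * p1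
    rw [this, abs_mul, abs_of_nonneg (by positivity : 0 ≤ (N : ℝ) ^ (1 / 4 : ℝ) / N)]
    have h1 : |mean e| ≤ 1 := abs_le.2 ⟨heM.1, heM.2.trans zero_le_one⟩
    calc _ ≤ (N : ℝ) ^ (1 / 4 : ℝ) / N * 1 := by gcongr
      _ ≤ _ := by rw [mul_one]; exact p4
  · intro i
    have : wCoord d s X i - (z i - mean z) = (N : ℝ) ^ (1 / 2 : ℝ) / N * (e i - mean e) := by
      rw [wCoord, hmean, hx]
      field_simp
      linear_combination (z i - mean z) * p2
    rw [this, abs_mul, abs_of_nonneg (by positivity : 0 ≤ (N : ℝ) ^ (1 / 2 : ℝ) / N), ← p3]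
    have h1 : |e i - mean e| ≤ 1 := abs_le.2
      ⟨by linarith [(heI i).1, heM.2], by linarith [(heI i).2, heM.1]⟩
    calc _ ≤ (N : ℝ) ^ (1 / 2 : ℝ) / N * 1 := by gcongr
      _ = _ := mul_one _

theorem countVec_eq_of_mem_cell {X Y : Fin N → Fin (d + 1)} {z : Fin d → ℝ}
    (hX : z ∈ cell d s X) (hY : z ∈ cell d s Y) : countVec Y = countVec X := by
  have hs (i : Fin d) : countVec Y i.succ = countVec X i.succ := by
    exact_mod_cast (hY i).symm.trans (hX i)
  have h1 := sum_countVec X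
  have h2 := sum_countVec Y
  rw [Fin.sum_univ_succ] at h1 h2
  simp only [hs] at h2
  ext r
  refine Fin.cases ?_ (fun i => hs i) r
  omega

theorem mem_cell_iff {X Y : Fin N → Fin (d + 1)} {z : Fin d → ℝ} (hX : z ∈ cell d s X) :
    z ∈ cell d s Y ↔ countVec Y = countVec X :=
  ⟨fun hY => countVec_eq_of_mem_cell hX hY, fun h i => by rw [h]; exact hX i⟩

theorem magnetization_congr {q : ℕ} {X Y : Fin N → Fin q} (h : countVec Y = countVec X) :
    magnetization q N Y = magnetization q N X := by
  ext r
  rw [magnetization_eq, magnetization_eq, h]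

/-- The configurations whose cell contains `z` are exactly those with the counts of `X`, so the sum
is one term times their number. -/
theorem sum_indicator_cell (hN : N ≠ 0) {p : ℕ} {β h : ℝ} {g : (Fin N → Fin (d + 1)) → ℝ}
    {X : Fin N → Fin (d + 1)} (hg : ∀ Y, countVec Y = countVec X → g Y = g X) {z : Fin d → ℝ}
    (hX : z ∈ cell d s X) :
    ∑ Y, (cell d s Y).indicator (fun _ => weight p (d + 1) β h N Y * g Y) z =
      (stirlingQuot N / ∏ r, stirlingQuot (countVec X r)) *
        Real.exp (N * negFreeEnergy p (d + 1) β h (magnetization (d + 1) N X)) * g X := by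
  classical
  rw [← card_mul_weight hN X, mul_assoc, ← nsmul_eq_mul, ← Finset.sum_const, Finset.sum_filter]
  refine Finset.sum_congr rfl fun Y _ => ?_
  rw [Set.indicator_apply]
  refine if_ctx_congr (mem_cell_iff hX) (fun hc => ?_) fun _ => rfl
  rw [weight, weight, magnetization_congr hc, hg Y hc]

/-- Every point is eventually rounded down to a configuration. -/
theorem eventually_exists_mem_cell (hs : s ∈ coordDomain d) (z : Fin d → ℝ) :
    ∀ᶠ N : ℕ in atTop, ∃ X : Fin N → Fin (d + 1), z ∈ cell d s X := by
  have hpow {e : ℝ} (he : e < 1) : Tendsto (fun N : ℕ => (N : ℝ) ^ e / N) atTop (𝓝 0) := by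
    refine (tendsto_rpow_neg_zero (e := e - 1) (by linarith)).congr' ?_
    filter_upwards [eventually_ne_atTop 0] with N hN
    rw [Real.rpow_sub_one (by positivity)]
  have hlim (i : Fin d) : Tendsto (fun N : ℕ => scaleMap d s N z i / N) atTop
      (𝓝 (tailCoord d s)) := by
    have h1 := (((hpow (e := 3 / 4) (by norm_num)).mul_const (mean z)).add
      ((hpow (e := 1 / 2) (by norm_num)).mul_const (z i - mean z))).const_add (tailCoord d s)
    simp only [zero_mul, add_zero] at h1
    refine h1.congr' ?_
    filter_upwards [eventually_ne_atTop 0] with N hN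
    have : (0 : ℝ) < N := by positivity
    simp only [scaleMap]
    field_simp
  have hsum : Tendsto (fun N : ℕ => ∑ i, scaleMap d s N z i / N) atTop
      (𝓝 (d * tailCoord d s)) := by
    have := tendsto_finsetSum Finset.univ fun i _ => hlim i
    simpa using this
  -- This leaves room for the first color, which receives the sites not used by the others.
  have hlt : d * tailCoord d s < 1 := by linarith [headCoord_add d s, hs.1]
  have hpos : ∀ᶠ N : ℕ in atTop, ∀ i, 0 < scaleMap d s N z i / N :=
    eventually_all.2 fun i => (hlim i).eventually (lt_mem_nhds hs.2)
  filter_upwards [hpos, hsum.eventually (gt_mem_nhds hlt), eventually_ne_atTop 0] with N h1 h2 hN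
  have hN' : (0 : ℝ) < N := by positivity
  have h1' (i : Fin d) : 0 ≤ scaleMap d s N z i := by
    have := mul_pos (h1 i) hN'
    rw [div_mul_cancel₀ _ hN'.ne'] at this
    exact this.le
  have h2' : ∑ i, ⌊scaleMap d s N z i⌋₊ ≤ N := by
    have e1 : ((∑ i, ⌊scaleMap d s N z i⌋₊ : ℕ) : ℝ) ≤ ∑ i, scaleMap d s N z i := by
      push_cast
      exact Finset.sum_le_sum fun i _ => Nat.floor_le (h1' i)
    rw [← Finset.sum_div, div_lt_one hN'] at h2
    exact_mod_cast e1.trans h2.le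
  obtain ⟨X, hX⟩ := exists_countVec_eq (N := N) (Fin.cons (N - ∑ i, ⌊scaleMap d s N z i⌋₊)
    fun i : Fin d => ⌊scaleMap d s N z i⌋₊) (by
      rw [Fin.sum_univ_succ]
      simp only [Fin.cons_zero, Fin.cons_succ]
      omega)
  refine ⟨X, fun i => ?_⟩
  rw [hX, Fin.cons_succ, Int.natCast_floor_eq_floor (h1' i)]

end

section

variable {p d N : ℕ} {β h s : ℝ}

/-! ### Convergence and domination of the rescaled weights -/

theorem negFreeEnergy_add (βbar hbar c : ℝ) (x : Vec (d + 1)) :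
    negFreeEnergy p (d + 1) (β + c * βbar) (h + c * hbar) x =
      negFreeEnergy p (d + 1) β h x + c * perturbation p d βbar hbar x := by
  simp only [negFreeEnergy, perturbation]
  ring

/-- The total weight of the configurations with the same magnetization, relative to the maximizer
and normalized. -/
noncomputable def rescaledWeight (p d : ℕ) (β h βbar hbar s : ℝ) (X : Fin N → Fin (d + 1)) : ℝ :=
  (stirlingQuot N / √N) / (∏ r, (stirlingQuot (countVec X r) / √N)) *
    Real.exp (N * (negFreeEnergy p (d + 1) β h (magnetization (d + 1) N X) -
      negFreeEnergy p (d + 1) β h (xvec (d + 1) s)) + (N : ℝ) ^ (1 / 4 : ℝ) *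
        (perturbation p d βbar hbar (magnetization (d + 1) N X) -
          perturbation p d βbar hbar (xvec (d + 1) s)))

/-- The limit of the rescaled weights in the variables `t` and `w`. -/
noncomputable def limitWeight (p d : ℕ) (β h βbar hbar s t : ℝ) (w : Fin d → ℝ) : ℝ :=
  (√2 * √Real.pi) / (∏ r, (√2 * √Real.pi * √(xvec (d + 1) s r))) *
    Real.exp ((t ^ 4 / 24 * (d + 1) ^ 4 * iteratedDeriv 4 (profile p (d + 1) β h) s +
      kfunD2 p β (tailCoord d s) / 2 * ∑ i, w i ^ 2) +
      (βbar * p * (∑ r, xvec (d + 1) s r ^ (p - 1) * uvec (d + 1) r) +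
        hbar * (1 - (d + 1 : ℕ))) * t)

/-- The normalization of the rescaled weights. -/
noncomputable def weightScale (p d : ℕ) (β h βbar hbar s : ℝ) (N : ℕ) : ℝ :=
  √N ^ d * Real.exp (-(N * negFreeEnergy p (d + 1) β h (xvec (d + 1) s) +
    (N : ℝ) ^ (1 / 4 : ℝ) * perturbation p d βbar hbar (xvec (d + 1) s)))

/-- Dividing all `d + 1` factors of the product and the single numerator by `√N` leaves `√N ^ d`;
the exponents match because `N * N^(-3/4) = N^(1/4)`. -/
theorem weightScale_mul (hN : N ≠ 0) (βbar hbar : ℝ) (X : Fin N → Fin (d + 1)) :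
    weightScale p d β h βbar hbar s N * ((stirlingQuot N / ∏ r, stirlingQuot (countVec X r)) *
      Real.exp (N * negFreeEnergy p (d + 1) (β + (N : ℝ) ^ (-(3 / 4) : ℝ) * βbar)
        (h + (N : ℝ) ^ (-(3 / 4) : ℝ) * hbar) (magnetization (d + 1) N X))) =
      rescaledWeight p d β h βbar hbar s X := by
  have hN' : (0 : ℝ) < N := by positivity
  have hsq : 0 < √(N : ℝ) := Real.sqrt_pos.2 hN'
  have hpos : 0 < ∏ r, stirlingQuot (countVec X r) :=
    Finset.prod_pos fun r _ => zero_lt_one.trans_le (one_le_stirlingQuot _)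
  have e : (N : ℝ) * (N : ℝ) ^ (-(3 / 4) : ℝ) = (N : ℝ) ^ (1 / 4 : ℝ) := by
    rw [mul_comm, ← Real.rpow_add_one hN'.ne']; norm_num
  rw [weightScale, rescaledWeight, negFreeEnergy_add, Finset.prod_div_distrib]
  simp only [Finset.prod_const, Finset.card_univ, Fintype.card_fin]
  have e2 (a b P L : ℝ) : Real.exp (-(N * b + (N : ℝ) ^ (1 / 4 : ℝ) * L)) *
      Real.exp (N * (a + (N : ℝ) ^ (-(3 / 4) : ℝ) * P)) =
      Real.exp (N * (a - b) + (N : ℝ) ^ (1 / 4 : ℝ) * (P - L)) := by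
    rw [← Real.exp_add]
    congr 1
    linear_combination P * e
  rw [← e2]
  field_simp
  ring

theorem tendsto_shiftVec {t : ℕ → ℝ} {w : ℕ → Fin d → ℝ} {t₀ : ℝ} {w₀ : Fin d → ℝ}
    (ht : Tendsto t atTop (𝓝 t₀)) (hw : ∀ i, Tendsto (fun N => w N i) atTop (𝓝 (w₀ i)))
    (r : Fin (d + 1)) : Tendsto (fun N : ℕ => shiftVec d s ((N : ℝ) ^ (-(1 / 4) : ℝ) * t N)
      (fun i => (N : ℝ) ^ (-(1 / 2) : ℝ) * w N i) r) atTop (𝓝 (xvec (d + 1) s r)) := by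
  have hq : Tendsto (fun N : ℕ => (N : ℝ) ^ (-(1 / 4) : ℝ)) atTop (𝓝 0) :=
    tendsto_rpow_neg_zero (by norm_num)
  have hh : Tendsto (fun N : ℕ => (N : ℝ) ^ (-(1 / 2) : ℝ)) atTop (𝓝 0) :=
    tendsto_rpow_neg_zero (by norm_num)
  have ha : Tendsto (fun N : ℕ => (N : ℝ) ^ (-(1 / 4) : ℝ) * t N) atTop (𝓝 0) := by
    simpa using hq.mul ht
  have hb (i : Fin d) : Tendsto (fun N : ℕ => (N : ℝ) ^ (-(1 / 2) : ℝ) * w N i) atTop (𝓝 0) := by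
    simpa using hh.mul (hw i)
  refine Fin.cases ?_ (fun i => ?_) r
  · simpa using (ha.const_mul (d : ℝ)).const_sub (headCoord d s)
  · simpa using (ha.const_add (tailCoord d s)).add (hb i)

theorem xvec_pos (hs : s ∈ coordDomain d) (r : Fin (d + 1)) : 0 < xvec (d + 1) s r := by
  refine Fin.cases ?_ (fun i => ?_) r
  · simpa using hs.1
  · simpa using hs.2

theorem IsQuarticMax.tendsto_rescaledWeight (hp : 2 ≤ p) (hd : 1 ≤ d)
    (H : IsQuarticMax p d β h s) (βbar hbar : ℝ) {X : (N : ℕ) → Fin N → Fin (d + 1)}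
    {t₀ : ℝ} {w₀ : Fin d → ℝ} (ht : Tendsto (fun N => tCoord d s (X N)) atTop (𝓝 t₀))
    (hw : ∀ i, Tendsto (fun N => wCoord d s (X N) i) atTop (𝓝 (w₀ i))) :
    Tendsto (fun N => rescaledWeight p d β h βbar hbar s (X N)) atTop
      (𝓝 (limitWeight p d β h βbar hbar s t₀ w₀)) := by
  have hmag : ∀ᶠ N : ℕ in atTop, shiftVec d s ((N : ℝ) ^ (-(1 / 4) : ℝ) * tCoord d s (X N))
      (fun i => (N : ℝ) ^ (-(1 / 2) : ℝ) * wCoord d s (X N) i) = magnetization (d + 1) N (X N) := by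
    filter_upwards [eventually_ne_atTop 0] with N hN
      using (magnetization_eq_shiftVec hd hN (X N)).symm
  have hx (r : Fin (d + 1)) : Tendsto (fun N : ℕ => (countVec (X N) r : ℝ) / N) atTop
      (𝓝 (xvec (d + 1) s r)) := by
    refine (tendsto_shiftVec (s := s) ht hw r).congr' ?_
    filter_upwards [hmag] with N hN
    rw [hN, magnetization_eq]
  -- All coordinates of `x_s` are positive, so every count tends to infinity and Stirling's formula
  -- applies to each factor.
  have hcount (r : Fin (d + 1)) : Tendsto (fun N : ℕ => countVec (X N) r) atTop atTop := by
    rw [← tendsto_natCast_atTop_iff (R := ℝ)]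
    refine ((hx r).pos_mul_atTop (xvec_pos H.mem r) tendsto_natCast_atTop_atTop).congr' ?_
    filter_upwards [eventually_ne_atTop 0] with N hN
    have : (0 : ℝ) < N := by positivity
    field_simp
  have hst (r : Fin (d + 1)) : Tendsto (fun N : ℕ => stirlingQuot (countVec (X N) r) / √N) atTop
      (𝓝 (√2 * √Real.pi * √(xvec (d + 1) s r))) := by
    refine ((tendsto_stirlingQuot_div_sqrt.comp (hcount r)).mul (hx r).sqrt).congr' ?_
    filter_upwards [eventually_ne_atTop 0, (hcount r).eventually_ne_atTop 0] with N hN hc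
    have h1 : (0 : ℝ) < N := by positivity
    have h2 : (0 : ℝ) < countVec (X N) r := by positivity
    simp only [Function.comp]
    rw [Real.sqrt_div h2.le]
    field_simp
  have hpre := tendsto_stirlingQuot_div_sqrt.div
    (tendsto_finsetProd Finset.univ fun r _ => hst r) (Finset.prod_ne_zero_iff.2 fun r _ => by
      have := Real.sqrt_pos.2 (xvec_pos H.mem r)
      have := Real.pi_pos
      positivity)
  have hexp := (H.tendsto_negFreeEnergy hp ht hw fun N => sum_wCoord hd (X N)).add
    (tendsto_perturbation (p := p) βbar hbar s ht hw)
  refine (hpre.mul ((Real.continuous_exp.tendsto _).comp hexp)).congr' ?_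
  filter_upwards [hmag] with N hN
  simp only [rescaledWeight, Function.comp, hN]
  rfl

/-- A color with a positive share of the sites has `stirlingQuot n` of order at least `√N`. A rare
color may lose that factor, but then `E` is of order at least `N` and the exponential absorbs the
loss. -/
theorem one_div_stirlingQuot_le {ρ c E : ℝ} {n N : ℕ} (hN : N ≠ 0) (hρ : 0 < ρ) (hc : 0 < c)
    (hE : 0 ≤ E) (hn : ρ * N ≤ n ∨ ρ * N ≤ E) :
    √N / stirlingQuot n * Real.exp (-(c * E)) ≤ 1 / √ρ + 1 / (c * ρ) := by
  have hN' : (1 : ℝ) ≤ N := by exact_mod_cast Nat.one_le_iff_ne_zero.2 hN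
  have hst : 0 < stirlingQuot n := zero_lt_one.trans_le (one_le_stirlingQuot _)
  have hexp1 : Real.exp (-(c * E)) ≤ 1 := Real.exp_le_one_iff.2 (by nlinarith)
  rcases hn with hn | hn
  · have h1 : √ρ * √N ≤ stirlingQuot n := by
      rw [← Real.sqrt_mul hρ.le]
      exact (Real.sqrt_le_sqrt hn).trans (sqrt_le_stirlingQuot n)
    have h2 : √N / stirlingQuot n ≤ 1 / √ρ := by
      rw [div_le_div_iff₀ hst (Real.sqrt_pos.2 hρ)]
      linarith
    calc _ ≤ √N / stirlingQuot n * 1 := by gcongr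
      _ ≤ 1 / √ρ := by rw [mul_one]; exact h2
      _ ≤ _ := le_add_of_nonneg_right (by positivity)
  · have h1 : √N / stirlingQuot n ≤ N := by
      rw [div_le_iff₀ hst]
      have h3 : √(N : ℝ) ≤ N := (Real.sqrt_le_left (by linarith)).2 (by nlinarith)
      nlinarith [one_le_stirlingQuot n]
    have h2 : Real.exp (-(c * E)) ≤ Real.exp (-(c * ρ * N)) := Real.exp_le_exp.2 (by nlinarith)
    have h3 : N * Real.exp (-(c * ρ * N)) ≤ 1 / (c * ρ) := by
      have h4 := Real.mul_exp_neg_le_exp_neg_one (c * ρ * N)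
      have h5 : Real.exp (-1) ≤ 1 := Real.exp_le_one_iff.2 (by norm_num)
      rw [le_div_iff₀ (by positivity)]
      linarith
    calc _ ≤ N * Real.exp (-(c * ρ * N)) := by gcongr
      _ ≤ 1 / (c * ρ) := h3
      _ ≤ _ := le_add_of_nonneg_left (by positivity)

/-- Weakens quartic decay to Gaussian decay, so that one Gaussian majorant serves both kinds of
coordinates. -/
theorem quartic_linear_le {c C t : ℝ} (hc : 0 < c) : -(c * t ^ 4) + C * |t| ≤
    (c + C ^ 2 / (2 * c)) - c / 2 * t ^ 2 := by
  have h1 : C * |t| ≤ C ^ 2 / (2 * c) + c / 2 * t ^ 2 := by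
    have : 0 ≤ (C - c * |t|) ^ 2 / (2 * c) := by positivity
    have e : (C - c * |t|) ^ 2 / (2 * c) = C ^ 2 / (2 * c) - C * |t| + c / 2 * t ^ 2 := by
      rw [← sq_abs t]; field_simp; ring
    linarith
  nlinarith [mul_nonneg hc.le (sq_nonneg (t ^ 2 - 1 / 2))]

theorem quadratic_linear_le {c C t : ℝ} (hc : 0 < c) : -(c * t ^ 2) + C * |t| ≤
    C ^ 2 / (2 * c) - c / 2 * t ^ 2 := by
  have : 0 ≤ (C - c * |t|) ^ 2 / (2 * c) := by positivity
  have e : (C - c * |t|) ^ 2 / (2 * c) = C ^ 2 / (2 * c) - C * |t| + c / 2 * t ^ 2 := by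
    rw [← sq_abs t]; field_simp; ring
  linarith

/-- If one coordinate of `shiftVec` is far from the one of the maximizer, then the shift is not
small. -/
theorem exists_coord_lt {ρ : ℝ} (hd : 1 ≤ d) (hρ : 0 < ρ) : ∃ η > 0, ∀ (a : ℝ) (w : Fin d → ℝ)
    (r : Fin (d + 1)), shiftVec d s a w r ≤ xvec (d + 1) s r - ρ →
      η ≤ a ^ 4 + ∑ i, w i ^ 2 := by
  have hd' : (1 : ℝ) ≤ d := by exact_mod_cast hd
  -- If `|a| < ρ / (2 d)`, the shift along `u` moves any coordinate by less than `ρ / 2`, so `w`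
  -- must account for the remaining `ρ / 2`.
  refine ⟨min ((ρ / (2 * d)) ^ 4) ((ρ / 2) ^ 2), by positivity, fun a w r hr => ?_⟩
  have hsq : 0 ≤ ∑ i, w i ^ 2 := Finset.sum_nonneg fun i _ => sq_nonneg _
  have ha4 : 0 ≤ a ^ 4 := by positivity
  by_cases hcase : ρ / (2 * d) ≤ |a|
  · have : (ρ / (2 * d)) ^ 4 ≤ a ^ 4 := by
      rw [← Even.pow_abs (by decide) a]
      gcongr
    linarith [min_le_left ((ρ / (2 * d)) ^ 4) ((ρ / 2) ^ 2)]
  · push Not at hcase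
    have hcase' : d * |a| < ρ / 2 := by
      rw [lt_div_iff₀ (by positivity)] at hcase
      linarith
    have ha1 : |a| < ρ / 2 := by nlinarith [abs_nonneg a]
    revert hr
    refine Fin.cases (fun hr => ?_) (fun i hr => ?_) r
    · rw [shiftVec_zero, xvec_zero] at hr
      nlinarith [le_abs_self a]
    · rw [shiftVec_succ, xvec_succ] at hr
      have h1 : (ρ / 2) ^ 2 ≤ w i ^ 2 := by
        have : ρ / 2 ≤ -w i := by linarith [neg_abs_le a]
        nlinarith
      have h2 := Finset.single_le_sum (f := fun i => w i ^ 2) (fun j _ => sq_nonneg _)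
        (Finset.mem_univ i)
      linarith [min_le_right ((ρ / (2 * d)) ^ 4) ((ρ / 2) ^ 2)]

theorem IsQuarticMax.exists_rescaledWeight_le_coord (hp : 2 ≤ p) (hd : 1 ≤ d)
    (H : IsQuarticMax p d β h s) (βbar hbar : ℝ) : ∃ K c C : ℝ, 0 ≤ K ∧ 0 < c ∧
      ∀ (N : ℕ) (X : Fin N → Fin (d + 1)), N ≠ 0 → rescaledWeight p d β h βbar hbar s X ≤
        K * Real.exp (-(c * (tCoord d s X ^ 4 + ∑ i, wCoord d s X i ^ 2)) +
          C * (|tCoord d s X| + ∑ i, |wCoord d s X i|)) := by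
  have hd' : (1 : ℝ) ≤ d := by exact_mod_cast hd
  obtain ⟨c, hc, hle⟩ := H.exists_negFreeEnergy_le hp hd
  obtain ⟨ρ₀, hρ₀, hρ₀le⟩ : ∃ ρ₀ > 0, ∀ r, 2 * ρ₀ ≤ xvec (d + 1) s r := by
    refine ⟨min (headCoord d s) (tailCoord d s) / 2, half_pos (lt_min H.mem.1 H.mem.2), fun r => ?_⟩
    rw [mul_div_cancel₀ _ two_ne_zero]
    refine Fin.cases ?_ (fun i => ?_) r
    · rw [xvec_zero]; exact min_le_left _ _
    · rw [xvec_succ]; exact min_le_right _ _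
  obtain ⟨η, hη, hηle⟩ := exists_coord_lt (s := s) hd hρ₀
  set ρ := min ρ₀ η with hρdef
  have hρ : 0 < ρ := lt_min hρ₀ hη
  -- Half of the decay `c E` is divided equally among the `d + 1` colors to control the Stirling
  -- factors; the other half stays in the bound.
  set c' := c / (2 * (d + 1)) with hc'def
  have hc' : 0 < c' := by positivity
  set M := 1 / √ρ + 1 / (c' * ρ) with hM
  set B := |βbar| * p + |hbar| with hB
  have hB0 : 0 ≤ B := by positivity
  refine ⟨Real.exp 1 * M ^ (d + 1), c / 2, B * (2 * d), by positivity, by positivity,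
    fun N X hN => ?_⟩
  have hN' : (1 : ℝ) ≤ N := by exact_mod_cast Nat.one_le_iff_ne_zero.2 hN
  have hN0 : (0 : ℝ) < N := by linarith
  set t := tCoord d s X
  set w := wCoord d s X
  set E := t ^ 4 + ∑ i, w i ^ 2 with hE
  have hE0 : 0 ≤ E := by
    have : 0 ≤ ∑ i, w i ^ 2 := Finset.sum_nonneg fun i _ => sq_nonneg _
    positivity
  set a := (N : ℝ) ^ (-(1 / 4) : ℝ) * t with ha
  set v : Fin d → ℝ := fun i => (N : ℝ) ^ (-(1 / 2) : ℝ) * w i with hv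
  have hmag : magnetization (d + 1) N X = shiftVec d s a v := magnetization_eq_shiftVec hd hN X
  have hmem : shiftVec d s a v ∈ probVectors (d + 1) := hmag ▸ magnetization_mem hN X
  have hv0 : ∑ i, v i = 0 := by
    simp only [hv]
    rw [← Finset.mul_sum, sum_wCoord hd X, mul_zero]
  have q4 : (N : ℝ) * ((N : ℝ) ^ (-(1 / 4) : ℝ)) ^ 4 = 1 := by
    rw [← Real.rpow_natCast, ← Real.rpow_mul hN0.le]
    norm_num
    rw [Real.rpow_neg_one]
    exact mul_inv_cancel₀ hN0.ne'
  have q2 : (N : ℝ) * ((N : ℝ) ^ (-(1 / 2) : ℝ)) ^ 2 = 1 := by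
    rw [← Real.rpow_natCast, ← Real.rpow_mul hN0.le]
    norm_num
    rw [Real.rpow_neg_one]
    exact mul_inv_cancel₀ hN0.ne'
  have hNE : N * (a ^ 4 + ∑ i, v i ^ 2) = E := by
    simp only [hE, ha, hv, mul_pow, ← Finset.mul_sum]
    linear_combination t ^ 4 * q4 + (∑ i, w i ^ 2) * q2
  have hen : N * (negFreeEnergy p (d + 1) β h (magnetization (d + 1) N X) -
      negFreeEnergy p (d + 1) β h (xvec (d + 1) s)) ≤ -(c * E) := by
    have := mul_le_mul_of_nonneg_left (hle a v hv0 hmem) hN0.le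
    rw [hmag]
    rw [← hNE]
    linarith
  have hpert : (N : ℝ) ^ (1 / 4 : ℝ) * (perturbation p d βbar hbar (magnetization (d + 1) N X) -
      perturbation p d βbar hbar (xvec (d + 1) s)) ≤ B * (2 * d) * (|t| + ∑ i, |w i|) := by
    have h1 := (le_abs_self _).trans (abs_perturbation_sub_le (p := p) βbar hbar H.mem hmem)
    have e1 : (N : ℝ) ^ (1 / 4 : ℝ) * (N : ℝ) ^ (-(1 / 4) : ℝ) = 1 := by
      rw [← Real.rpow_add hN0]; norm_num
    have e2 : (N : ℝ) ^ (1 / 4 : ℝ) * (N : ℝ) ^ (-(1 / 2) : ℝ) ≤ 1 := by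
      rw [← Real.rpow_add hN0]
      exact Real.rpow_le_one_of_one_le_of_nonpos hN' (by norm_num)
    have hw0 : 0 ≤ ∑ i, |w i| := Finset.sum_nonneg fun i _ => abs_nonneg _
    rw [hmag]
    calc _ ≤ (N : ℝ) ^ (1 / 4 : ℝ) * (B * (2 * d * |a| + ∑ i, |v i|)) := by gcongr
      _ = B * (2 * d * (((N : ℝ) ^ (1 / 4 : ℝ) * (N : ℝ) ^ (-(1 / 4) : ℝ)) * |t|) +
          ((N : ℝ) ^ (1 / 4 : ℝ) * (N : ℝ) ^ (-(1 / 2) : ℝ)) * ∑ i, |w i|) := by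
        simp only [ha, hv, abs_mul, ← Finset.mul_sum]
        rw [abs_of_nonneg (by positivity : 0 ≤ (N : ℝ) ^ (-(1 / 4) : ℝ)),
          abs_of_nonneg (by positivity : 0 ≤ (N : ℝ) ^ (-(1 / 2) : ℝ))]
        ring
      _ ≤ B * (2 * d * (1 * |t|) + 1 * ∑ i, |w i|) := by
        rw [e1]; gcongr
      _ ≤ B * (2 * d * |t| + 2 * d * ∑ i, |w i|) := by
        rw [one_mul]
        gcongr
        linarith
      _ = _ := by ring
  have hfac (r : Fin (d + 1)) :
      √N / stirlingQuot (countVec X r) * Real.exp (-(c' * E)) ≤ M := by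
    refine one_div_stirlingQuot_le hN hρ hc' hE0 ?_
    by_cases hr : shiftVec d s a v r ≤ xvec (d + 1) s r - ρ₀
    · right
      rw [← hNE, mul_comm]
      gcongr
      exact (min_le_right _ _).trans (hηle a v r hr)
    · left
      push Not at hr
      rw [← hmag, magnetization_eq, lt_div_iff₀ hN0] at hr
      have h1 := hρ₀le r
      have h2 : ρ ≤ xvec (d + 1) s r - ρ₀ := (min_le_left _ _).trans (by linarith)
      calc ρ * N ≤ (xvec (d + 1) s r - ρ₀) * N := by gcongr
        _ ≤ _ := hr.le
  have hprod : (∏ r, (√N / stirlingQuot (countVec X r))) * Real.exp (-(c / 2 * E)) ≤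
      M ^ (d + 1) := by
    have e : Real.exp (-(c / 2 * E)) = ∏ _r : Fin (d + 1), Real.exp (-(c' * E)) := by
      rw [Finset.prod_const, Finset.card_univ, Fintype.card_fin, ← Real.exp_nat_mul]
      congr 1
      rw [hc'def]
      push_cast
      field_simp
    rw [e, ← Finset.prod_mul_distrib]
    calc _ ≤ ∏ _r : Fin (d + 1), M := Finset.prod_le_prod (fun r _ => by
          have := zero_lt_one.trans_le (one_le_stirlingQuot (countVec X r))
          positivity) fun r _ => hfac r
      _ = _ := by simp
  have hhead : stirlingQuot N / √N ≤ Real.exp 1 := by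
    rw [div_le_iff₀ (Real.sqrt_pos.2 hN0)]
    exact stirlingQuot_le hN
  have hinv : (stirlingQuot N / √N) / (∏ r, (stirlingQuot (countVec X r) / √N)) =
      stirlingQuot N / √N * ∏ r, (√N / stirlingQuot (countVec X r)) := by
    rw [div_eq_mul_inv _ (∏ r, _), ← Finset.prod_inv_distrib]
    simp only [inv_div]
  have hst0 : 0 < stirlingQuot N := zero_lt_one.trans_le (one_le_stirlingQuot N)
  have hP0 : 0 ≤ ∏ r, (√N / stirlingQuot (countVec X r)) := Finset.prod_nonneg fun r _ => by
    have := zero_lt_one.trans_le (one_le_stirlingQuot (countVec X r))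
    positivity
  rw [rescaledWeight, hinv]
  calc _ ≤ Real.exp 1 * (∏ r, (√N / stirlingQuot (countVec X r))) *
        Real.exp (-(c * E) + B * (2 * d) * (|t| + ∑ i, |w i|)) := by gcongr
    _ = Real.exp 1 * ((∏ r, (√N / stirlingQuot (countVec X r))) * Real.exp (-(c / 2 * E))) *
        Real.exp (-(c / 2 * E) + B * (2 * d) * (|t| + ∑ i, |w i|)) := by
      rw [show -(c * E) + B * (2 * d) * (|t| + ∑ i, |w i|) = -(c / 2 * E) +
        (-(c / 2 * E) + B * (2 * d) * (|t| + ∑ i, |w i|)) by ring, Real.exp_add]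
      ring
    _ ≤ _ := by gcongr

theorem IsQuarticMax.exists_rescaledWeight_le (hp : 2 ≤ p) (hd : 1 ≤ d)
    (H : IsQuarticMax p d β h s) (βbar hbar : ℝ) : ∃ K ε : ℝ, 0 ≤ K ∧ 0 < ε ∧
      ∀ (N : ℕ) (X : Fin N → Fin (d + 1)) (z : Fin d → ℝ), N ≠ 0 → z ∈ cell d s X →
        rescaledWeight p d β h βbar hbar s X ≤ K * Real.exp (-(ε * ∑ i, z i ^ 2)) := by
  have hd' : (1 : ℝ) ≤ d := by exact_mod_cast hd
  obtain ⟨K, c, C, hK, hc, hle⟩ := H.exists_rescaledWeight_le_coord hp hd βbar hbar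
  -- The first three terms come from absorbing the linear terms into half of the decay. The last is
  -- the rounding error: `|z i - t - w i| ≤ 2` adds `12 d` to `∑ z i ^ 2`, at the rate `c / (6 d)`.
  set A := c + C ^ 2 / (2 * c) + d * (C ^ 2 / (2 * c)) + 2 * c with hA
  refine ⟨K * Real.exp A, c / (6 * d), by positivity, by positivity, fun N X z hN hz => ?_⟩
  refine (hle N X hN).trans ?_
  rw [mul_assoc, ← Real.exp_add]
  refine mul_le_mul_of_nonneg_left (Real.exp_le_exp.2 ?_) hK
  set t := tCoord d s X
  set w := wCoord d s X
  have hN1 : (N : ℝ) ^ (-(1 / 2) : ℝ) ≤ 1 := Real.rpow_le_one_of_one_le_of_nonpos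
    (by exact_mod_cast Nat.one_le_iff_ne_zero.2 hN) (by norm_num)
  obtain ⟨h1, h2⟩ := abs_coord_sub_le hd hN hz
  have hz2 : ∑ i, z i ^ 2 ≤ 3 * d * (t ^ 2 + ∑ i, w i ^ 2) + 12 * d := by
    have hi (i : Fin d) : z i ^ 2 ≤ 3 * t ^ 2 + 3 * w i ^ 2 + 12 := by
      have a1 := abs_le.1 (h1.trans hN1)
      have a2 := abs_le.1 ((h2 i).trans hN1)
      have hr : |z i - t - w i| ≤ 2 := abs_le.2 ⟨by linarith, by linarith⟩
      have hr2 : (z i - t - w i) ^ 2 ≤ 4 := by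
        have := abs_le.1 hr
        nlinarith
      nlinarith [sq_nonneg (t - w i), sq_nonneg (t - (z i - t - w i)),
        sq_nonneg (w i - (z i - t - w i))]
    have hsq : 0 ≤ ∑ i, w i ^ 2 := Finset.sum_nonneg fun i _ => sq_nonneg _
    calc _ ≤ ∑ i, (3 * t ^ 2 + 3 * w i ^ 2 + 12) := Finset.sum_le_sum fun i _ => hi i
      _ = 3 * d * t ^ 2 + 3 * ∑ i, w i ^ 2 + 12 * d := by
        simp only [Finset.sum_add_distrib, ← Finset.mul_sum]
        simp
        ring
      _ ≤ _ := by nlinarith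
  have hq := quartic_linear_le (C := C) (t := t) hc
  have hs : -(c * ∑ i, w i ^ 2) + C * ∑ i, |w i| ≤
      d * (C ^ 2 / (2 * c)) - c / 2 * ∑ i, w i ^ 2 := by
    have := Finset.sum_le_sum fun i (_ : i ∈ Finset.univ) =>
      quadratic_linear_le (C := C) (t := w i) hc
    simp only [Finset.sum_add_distrib, Finset.sum_sub_distrib, Finset.sum_neg_distrib,
      ← Finset.mul_sum] at this
    simpa using this
  have hfin : c / (6 * d) * ∑ i, z i ^ 2 ≤ c / 2 * (t ^ 2 + ∑ i, w i ^ 2) + 2 * c := by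
    calc _ ≤ c / (6 * d) * (3 * d * (t ^ 2 + ∑ i, w i ^ 2) + 12 * d) := by gcongr
      _ = _ := by field_simp; ring
  rw [hA]
  linarith

theorem rescaledWeight_nonneg (βbar hbar : ℝ) (X : Fin N → Fin (d + 1)) :
    0 ≤ rescaledWeight p d β h βbar hbar s X := by
  have (n : ℕ) : 0 ≤ stirlingQuot n := zero_le_one.trans (one_le_stirlingQuot n)
  have h2 : 0 ≤ ∏ r, (stirlingQuot (countVec X r) / √N) :=
    Finset.prod_nonneg fun r _ => div_nonneg (this _) (Real.sqrt_nonneg _)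
  have h3 := this N
  unfold rescaledWeight
  positivity

end

section

variable {p d : ℕ} {β h s : ℝ}

/-! ### Convergence of the expectations -/

/-- The limit of the rescaled weights in the variable `z`. -/
noncomputable def limitDens (p d : ℕ) (β h βbar hbar s : ℝ) (z : Fin d → ℝ) : ℝ :=
  limitWeight p d β h βbar hbar s (mean z) fun i => z i - mean z

/-- The expectation of `g` before normalization as the integral of this function. -/
noncomputable def scaledFun (p d : ℕ) (β h βbar hbar s : ℝ) (g : ℝ × (Fin d → ℝ) → ℝ) (N : ℕ)
    (z : Fin d → ℝ) : ℝ :=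
  weightScale p d β h βbar hbar s N * ∑ Y, (cell d s Y).indicator (fun _ =>
    weight p (d + 1) (β + (N : ℝ) ^ (-(3 / 4) : ℝ) * βbar) (h + (N : ℝ) ^ (-(3 / 4) : ℝ) * hbar) N Y *
      g (tCoord d s Y, wCoord d s Y)) z

theorem scaledFun_of_mem (βbar hbar : ℝ) (g : ℝ × (Fin d → ℝ) → ℝ) {N : ℕ} (hN : N ≠ 0)
    {X : Fin N → Fin (d + 1)} {z : Fin d → ℝ} (hX : z ∈ cell d s X) :
    scaledFun p d β h βbar hbar s g N z =
      rescaledWeight p d β h βbar hbar s X * g (tCoord d s X, wCoord d s X) := by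
  rw [scaledFun, sum_indicator_cell hN (g := fun Y => g (tCoord d s Y, wCoord d s Y)) _ hX,
    ← mul_assoc, weightScale_mul hN]
  intro Y hY
  have : (wCoord d s Y : Fin d → ℝ) = wCoord d s X := by
    ext i; simp only [wCoord, magnetization_congr hY]
  rw [this]
  simp only [tCoord, magnetization_congr hY]

theorem scaledFun_of_forall_notMem (βbar hbar : ℝ) (g : ℝ × (Fin d → ℝ) → ℝ) {N : ℕ}
    {z : Fin d → ℝ} (hz : ∀ X : Fin N → Fin (d + 1), z ∉ cell d s X) :
    scaledFun p d β h βbar hbar s g N z = 0 := by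
  rw [scaledFun, Finset.sum_eq_zero fun Y _ => Set.indicator_of_notMem (hz Y) _, mul_zero]

theorem measurable_scaledFun (βbar hbar : ℝ) (g : ℝ × (Fin d → ℝ) → ℝ) (N : ℕ) :
    Measurable (scaledFun p d β h βbar hbar s g N) := by
  unfold scaledFun
  exact (Finset.measurable_fun_sum _ fun Y _ =>
    measurable_const.indicator (measurableSet_cell Y)).const_mul _

theorem IsQuarticMax.tendsto_scaledFun (hp : 2 ≤ p) (hd : 1 ≤ d) (H : IsQuarticMax p d β h s)
    (βbar hbar : ℝ) {g : ℝ × (Fin d → ℝ) → ℝ} (hg : Continuous g) (z : Fin d → ℝ) :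
    Tendsto (fun N => scaledFun p d β h βbar hbar s g N z) atTop
      (𝓝 (limitDens p d β h βbar hbar s z * g (mean z, fun i => z i - mean z))) := by
  -- For the small `N` at which no cell contains `z`, an arbitrary configuration is taken, so that
  -- the sequence is defined everywhere.
  have hsel (N : ℕ) : ∃ X : Fin N → Fin (d + 1), (∃ Y : Fin N → Fin (d + 1), z ∈ cell d s Y) →
      z ∈ cell d s X := by
    by_cases hY : ∃ Y : Fin N → Fin (d + 1), z ∈ cell d s Y
    · exact ⟨hY.choose, fun _ => hY.choose_spec⟩
    · exact ⟨fun _ => 0, fun h => absurd h hY⟩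
  choose X hX using hsel
  have hev := eventually_exists_mem_cell H.mem z
  have hsmall : Tendsto (fun N : ℕ => (N : ℝ) ^ (-(1 / 2) : ℝ)) atTop (𝓝 0) :=
    tendsto_rpow_neg_zero (by norm_num)
  have ht : Tendsto (fun N => tCoord d s (X N)) atTop (𝓝 (mean z)) := by
    rw [← tendsto_sub_nhds_zero_iff]
    refine squeeze_zero_norm' ?_ hsmall
    filter_upwards [hev, eventually_ne_atTop 0] with N h1 hN
    exact (abs_coord_sub_le hd hN (hX N h1)).1
  have hw (i : Fin d) : Tendsto (fun N => wCoord d s (X N) i) atTop (𝓝 (z i - mean z)) := by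
    rw [← tendsto_sub_nhds_zero_iff]
    refine squeeze_zero_norm' ?_ hsmall
    filter_upwards [hev, eventually_ne_atTop 0] with N h1 hN
    exact (abs_coord_sub_le hd hN (hX N h1)).2 i
  have hpair : Tendsto (fun N => (tCoord d s (X N), (wCoord d s (X N) : Fin d → ℝ))) atTop
      (𝓝 (mean z, fun i => z i - mean z)) :=
    ht.prodMk_nhds (tendsto_pi_nhds.2 hw)
  refine ((H.tendsto_rescaledWeight hp hd βbar hbar ht hw).mul
    ((hg.tendsto _).comp hpair)).congr' ?_
  filter_upwards [hev, eventually_ne_atTop 0] with N h1 hN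
  rw [scaledFun_of_mem βbar hbar g hN (hX N h1)]
  rfl

theorem IsQuarticMax.exists_abs_scaledFun_le (hp : 2 ≤ p) (hd : 1 ≤ d) (H : IsQuarticMax p d β h s)
    (βbar hbar : ℝ) : ∃ K ε : ℝ, 0 ≤ K ∧ 0 < ε ∧ ∀ (g : ℝ × (Fin d → ℝ) → ℝ) (B : ℝ),
      (∀ x, |g x| ≤ B) → ∀ (N : ℕ) (z : Fin d → ℝ), N ≠ 0 →
        |scaledFun p d β h βbar hbar s g N z| ≤ K * Real.exp (-(ε * ∑ i, z i ^ 2)) * B := by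
  obtain ⟨K, ε, hK, hε, hle⟩ := H.exists_rescaledWeight_le hp hd βbar hbar
  refine ⟨K, ε, hK, hε, fun g B hB N z hN => ?_⟩
  have hB0 : 0 ≤ B := (abs_nonneg _).trans (hB 0)
  by_cases hz : ∃ X : Fin N → Fin (d + 1), z ∈ cell d s X
  · obtain ⟨X, hX⟩ := hz
    rw [scaledFun_of_mem βbar hbar g hN hX, abs_mul, abs_of_nonneg (rescaledWeight_nonneg _ _ _)]
    gcongr
    · exact hle N X z hN hX
    · exact hB _
  · push Not at hz
    rw [scaledFun_of_forall_notMem βbar hbar g hz, abs_zero]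
    positivity

theorem integrable_exp_neg_mul_sum_sq {ε : ℝ} (hε : 0 < ε) :
    Integrable fun z : Fin d → ℝ => Real.exp (-(ε * ∑ i, z i ^ 2)) := by
  have h1 := Integrable.fintype_prod (ι := Fin d) (μ := fun _ => (volume : Measure ℝ))
    fun _ => integrable_exp_neg_mul_sq hε
  refine h1.congr (Eventually.of_forall fun z => ?_)
  simp only [← Real.exp_sum, Finset.mul_sum, neg_mul, Finset.sum_neg_distrib]

theorem IsQuarticMax.tendsto_integral_scaledFun (hp : 2 ≤ p) (hd : 1 ≤ d)
    (H : IsQuarticMax p d β h s) (βbar hbar : ℝ) {g : ℝ × (Fin d → ℝ) → ℝ} (hg : Continuous g)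
    {B : ℝ} (hB : ∀ x, |g x| ≤ B) :
    Tendsto (fun N => ∫ z, scaledFun p d β h βbar hbar s g N z) atTop
      (𝓝 (∫ z, limitDens p d β h βbar hbar s z * g (mean z, fun i => z i - mean z))) := by
  obtain ⟨K, ε, hK, hε, hle⟩ := H.exists_abs_scaledFun_le hp hd βbar hbar
  refine tendsto_integral_filter_of_dominated_convergence
    (fun z => K * Real.exp (-(ε * ∑ i, z i ^ 2)) * B) ?_ ?_ ?_ ?_
  · exact Eventually.of_forall fun N => (measurable_scaledFun _ _ _ _).aestronglyMeasurable
  · filter_upwards [eventually_ne_atTop 0] with N hN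
    exact Eventually.of_forall fun z => hle g B hB N z hN
  · exact ((integrable_exp_neg_mul_sum_sq hε).const_mul K).mul_const B
  · exact Eventually.of_forall fun z => H.tendsto_scaledFun hp hd βbar hbar hg z

theorem limitDens_pos (hs : s ∈ coordDomain d) (βbar hbar : ℝ) (z : Fin d → ℝ) :
    0 < limitDens p d β h βbar hbar s z := by
  have : 0 < ∏ r, (√2 * √Real.pi * √(xvec (d + 1) s r)) := Finset.prod_pos fun r _ => by
    have := Real.sqrt_pos.2 (xvec_pos hs r)
    have := Real.pi_pos
    positivity
  have := Real.pi_pos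
  unfold limitDens limitWeight
  positivity

theorem continuous_limitDens (βbar hbar : ℝ) : Continuous (limitDens p d β h βbar hbar s) := by
  unfold limitDens limitWeight
  fun_prop

/-- Integrability is inherited from the majorant, since the density is the pointwise limit of
`scaledFun` with `g = 1`. -/
theorem IsQuarticMax.integral_limitDens_pos (hp : 2 ≤ p) (hd : 1 ≤ d)
    (H : IsQuarticMax p d β h s) (βbar hbar : ℝ) :
    0 < ∫ z, limitDens p d β h βbar hbar s z := by
  obtain ⟨K, ε, hK, hε, hle⟩ := H.exists_abs_scaledFun_le hp hd βbar hbar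
  have hint : Integrable (limitDens p d β h βbar hbar s) := by
    refine ((integrable_exp_neg_mul_sum_sq hε).const_mul K).mono'
      (continuous_limitDens _ _).aestronglyMeasurable (Eventually.of_forall fun z => ?_)
    have h1 := (H.tendsto_scaledFun hp hd βbar hbar (g := fun _ => 1) continuous_const z).abs
    rw [mul_one] at h1
    refine le_of_tendsto h1 ?_
    filter_upwards [eventually_ne_atTop 0] with N hN
    have := hle (fun _ => 1) 1 (by simp) N z hN
    rwa [mul_one] at this
  rw [integral_pos_iff_support_of_nonneg (fun z => (limitDens_pos H.mem _ _ z).le) hint]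
  have : Function.support (limitDens p d β h βbar hbar s) = Set.univ :=
    Set.eq_univ_of_forall fun z => (limitDens_pos H.mem _ _ z).ne'
  rw [this]
  exact Measure.measure_univ_pos.2 (NeZero.ne _)

theorem integral_pottsMeasure {q N : ℕ} [NeZero q] (g : (Fin N → Fin q) → ℝ) :
    ∫ X, g X ∂(pottsMeasure p q β h N) =
      (∑ X, weight p q β h N X * g X) / ∑ X : Fin N → Fin q, weight p q β h N X := by
  rw [pottsMeasure, PMF.integral_eq_sum, Finset.sum_div]
  refine Finset.sum_congr rfl fun X _ => ?_
  have hw : 0 ≤ weight p q β h N X / ∑ Y : Fin N → Fin q, weight p q β h N Y :=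
    div_nonneg (Real.exp_pos _).le (sum_weight_pos p q β h N).le
  rw [pottsPMF, PMF.ofFintype_apply, ENNReal.toReal_ofReal hw, smul_eq_mul]
  ring

/-- Numerator and partition function carry the same normalization and the same cell volume, so the
expectation is a quotient of two convergent integrals. -/
theorem IsQuarticMax.tendsto_expectation (hp : 2 ≤ p) (hd : 1 ≤ d)
    (H : IsQuarticMax p d β h s) (βbar hbar : ℝ) {g : ℝ × (Fin d → ℝ) → ℝ} (hg : Continuous g)
    {B : ℝ} (hB : ∀ x, |g x| ≤ B) :
    Tendsto (fun N : ℕ => ∫ X, g (tCoord d s X, wCoord d s X)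
      ∂(pottsMeasure p (d + 1) (β + (N : ℝ) ^ (-(3 / 4) : ℝ) * βbar)
        (h + (N : ℝ) ^ (-(3 / 4) : ℝ) * hbar) N)) atTop
      (𝓝 ((∫ z, limitDens p d β h βbar hbar s z * g (mean z, fun i => z i - mean z)) /
        ∫ z, limitDens p d β h βbar hbar s z)) := by
  have h1 := H.tendsto_integral_scaledFun hp hd βbar hbar hg hB
  have h2 := H.tendsto_integral_scaledFun hp hd βbar hbar (g := fun _ => 1) continuous_const
    (B := 1) (by simp)
  simp only [mul_one] at h2
  refine (h1.div h2 (H.integral_limitDens_pos hp hd βbar hbar).ne').congr' ?_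
  filter_upwards [eventually_ne_atTop 0] with N hN
  obtain ⟨K, hK, hint⟩ := exists_sum_eq_integral hd hN s
  have hN' : (0 : ℝ) < N := by positivity
  have hW : 0 < weightScale p d β h βbar hbar s N := by
    have := Real.sqrt_pos.2 hN'
    unfold weightScale
    positivity
  simp only [scaledFun, Pi.div_apply]
  rw [integral_pottsMeasure, integral_const_mul, integral_const_mul, hint, hint]
  simp only [mul_one]
  field_simp

end

section

variable {p d : ℕ} {β h s : ℝ}

/-! ### The limiting covariance matrix -/

/-- The matrix of the projection that kills the first coordinate and centers the other ones. -/
noncomputable def centerMat (d : ℕ) : Matrix (Fin (d + 1)) (Fin (d + 1)) ℝ :=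
  Matrix.of fun r r' => if r = 0 ∨ r' = 0 then 0 else (if r = r' then 1 else 0) - 1 / (d : ℝ)

/-- The vector `(0, z - mean z)`. -/
noncomputable def resid (z : Fin d → ℝ) : Vec (d + 1) :=
  WithLp.toLp 2 (Fin.cons 0 fun i => z i - mean z)

theorem centerMat_mulVec (x : Fin (d + 1) → ℝ) :
    (centerMat d).mulVec x = Fin.cons 0 fun i => x i.succ - mean fun i => x i.succ := by
  ext r
  refine Fin.cases ?_ (fun i => ?_) r
  · simp [centerMat, Matrix.mulVec, dotProduct]
  · simp only [centerMat, Matrix.mulVec, dotProduct, Fin.sum_univ_succ, Matrix.of_apply,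
      Fin.succ_ne_zero, false_or, if_true, zero_mul, zero_add, Fin.cons_succ, if_false,
      Fin.succ_inj, sub_mul, ite_mul, one_mul, Finset.sum_sub_distrib, Finset.sum_ite_eq,
      Finset.mem_univ, mean, ← Finset.mul_sum]
    ring

theorem centerMat_mul_self (hd : 1 ≤ d) : centerMat d * centerMat d = centerMat d := by
  rw [Matrix.ext_iff_mulVec]
  intro x
  rw [← Matrix.mulVec_mulVec, centerMat_mulVec, centerMat_mulVec]
  simp only [Fin.cons_succ, mean_sub_mean hd, sub_zero]

theorem centerMat_conjTranspose : (centerMat d).conjTranspose = centerMat d := by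
  ext r r'
  simp only [centerMat, Matrix.conjTranspose_apply, Matrix.of_apply, star_trivial]
  simp only [or_comm, eq_comm]

theorem posSemidef_centerMat (hd : 1 ≤ d) : (centerMat d).PosSemidef := by
  have := Matrix.posSemidef_conjTranspose_mul_self (centerMat d)
  rwa [centerMat_conjTranspose, centerMat_mul_self hd] at this

/-- The rank of an idempotent is its trace, here `d (1 - 1 / d)`. -/
theorem rank_centerMat (hd : 1 ≤ d) : (centerMat d).rank = d - 1 := by
  have hd' : (0 : ℝ) < d := by exact_mod_cast hd
  have hidem : IsIdempotentElem (Matrix.toLin' (centerMat d)) := by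
    rw [IsIdempotentElem, Module.End.mul_eq_comp, ← Matrix.toLin'_mul, centerMat_mul_self hd]
  have htr := (LinearMap.IsIdempotentElem.isProj_range _ hidem).trace
  rw [Matrix.trace_toLin'_eq] at htr
  have htr' : (centerMat d).trace = (d - 1 : ℕ) := by
    rw [Matrix.trace, Fin.sum_univ_succ]
    simp [centerMat, Nat.cast_sub hd]
    field_simp
  rw [htr'] at htr
  rw [Matrix.rank, ← Matrix.toLin'_apply']
  exact_mod_cast htr.symm

/-- The inverse of the variance of the limit of the orthogonal fluctuations. -/
noncomputable def precision (p d : ℕ) (β s : ℝ) : ℝ :=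
  -- For `d = 1` the residuals and `centerMat` vanish, so any positive value would do.
  if 2 ≤ d then -kfunD2 p β (tailCoord d s) else 1

theorem IsQuarticMax.precision_pos (H : IsQuarticMax p d β h s) : 0 < precision p d β s := by
  unfold precision
  split_ifs with hd
  · linarith [H.tail_neg hd]
  · exact one_pos

theorem limitCov_eq (hp : 2 ≤ p) (hd : 1 ≤ d) (hs : s ∈ coordDomain d) :
    limitCov p (d + 1) β s = (precision p d β s)⁻¹ • centerMat d := by
  have hd' : (0 : ℝ) < d := by exact_mod_cast hd
  have ht : (1 - s) / ((d + 1 : ℕ) : ℝ) = tailCoord d s := by simp [tailCoord]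
  rw [limitCov, ht, iteratedDeriv_two_kfun hp hs.2]
  rcases hd.eq_or_lt with rfl | hd2
  · ext r r'
    simp only [Matrix.smul_apply, Matrix.of_apply, centerMat, smul_eq_mul]
    fin_cases r <;> fin_cases r' <;> simp
  · ext r r'
    simp only [Matrix.smul_apply, Matrix.of_apply, centerMat, smul_eq_mul, precision,
      if_pos (show 2 ≤ d from hd2)]
    by_cases h0 : r = 0 ∨ r' = 0
    · simp [h0]
    · simp only [if_neg h0]
      push_cast
      rw [add_sub_cancel_right, neg_mul, one_div, ← mul_neg, mul_inv, mul_comm (d : ℝ)⁻¹, mul_assoc]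
      congr 1
      split_ifs <;> field_simp <;> ring

theorem dotProduct_centerMat_mulVec (hd : 1 ≤ d) (x : Fin (d + 1) → ℝ) :
    x ⬝ᵥ (centerMat d).mulVec x = ∑ i : Fin d, (x i.succ - mean fun i => x i.succ) ^ 2 := by
  rw [centerMat_mulVec, dotProduct, Fin.sum_univ_succ]
  simp only [Fin.cons_zero, Fin.cons_succ, mul_zero, zero_add]
  have h0 := sum_sub_mean hd fun i => x i.succ
  have : ∑ i : Fin d, (mean fun i => x i.succ) * (x i.succ - mean fun i => x i.succ) = 0 := by
    rw [← Finset.mul_sum, h0, mul_zero]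
  rw [← sub_zero (∑ i : Fin d, x i.succ * _), ← this, ← Finset.sum_sub_distrib]
  exact Finset.sum_congr rfl fun i _ => by ring

theorem sum_sq_eq (hd : 1 ≤ d) (z : Fin d → ℝ) :
    ∑ i, z i ^ 2 = d * mean z ^ 2 + ∑ i, (z i - mean z) ^ 2 := by
  have h1 : ∑ i, 2 * mean z * (z i - mean z) = 0 := by
    rw [← Finset.mul_sum, sum_sub_mean hd, mul_zero]
  have h2 : ∑ _i : Fin d, mean z ^ 2 = d * mean z ^ 2 := by simp
  rw [← h2, ← add_zero (∑ _i : Fin d, mean z ^ 2), ← h1, ← Finset.sum_add_distrib,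
    ← Finset.sum_add_distrib]
  exact Finset.sum_congr rfl fun i _ => by ring

/-! ### Independence of the mean and the residuals of a Gaussian vector -/

/-- The density of a centered Gaussian vector with independent coordinates of variance `κ⁻¹`. -/
noncomputable def gaussDens (d : ℕ) (κ : ℝ) (z : Fin d → ℝ) : ℝ :=
  ((Real.pi / (κ / 2)) ^ ((d : ℝ) / 2))⁻¹ * Real.exp (-(κ / 2 * ∑ i, z i ^ 2))

theorem continuous_gaussDens (κ : ℝ) : Continuous (gaussDens d κ) := by
  unfold gaussDens; fun_prop

theorem continuous_mean_resid : Continuous fun z : Fin d → ℝ => (mean z, resid z) := by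
  unfold resid
  refine continuous_mean.prodMk ((PiLp.continuous_toLp 2 _).comp (continuous_pi fun r => ?_))
  refine Fin.cases ?_ (fun i => ?_) r
  · simpa using continuous_const
  · simp only [Fin.cons_succ]
    fun_prop

/-- Pairing `(mean z, resid z)` with `(a, v)` is a linear form `c` in `z`, and the transform of an
isotropic Gaussian depends only on `|c|^2 = a^2 / d + ∑ (v j - V)^2`. The absence of a cross term
factorizes the characteristic function. -/
theorem map_mean_resid (hd : 1 ≤ d) {κ : ℝ} (hκ : 0 < κ) :
    ((volume : Measure (Fin d → ℝ)).withDensity fun z => ENNReal.ofReal (gaussDens d κ z)).map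
      (fun z => (mean z, resid z)) =
      (gaussianReal 0 (Real.toNNReal (κ * d)⁻¹)).prod
        (multivariateGaussian 0 (κ⁻¹ • centerMat d)) := by
  have hd' : (0 : ℝ) < d := by exact_mod_cast hd
  have hnn (z : Fin d → ℝ) : 0 ≤ gaussDens d κ z := by
    have := Real.pi_pos
    unfold gaussDens; positivity
  have hint : Integrable (gaussDens d κ) := by
    unfold gaussDens
    exact (integrable_exp_neg_mul_sum_sq (half_pos hκ)).const_mul _
  have : IsFiniteMeasure ((volume : Measure (Fin d → ℝ)).withDensity
      fun z => ENNReal.ofReal (gaussDens d κ z)) := isFiniteMeasure_withDensity_ofReal hint.2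
  rw [← charFun_eq_prod_iff]
  intro x
  set a : ℝ := x.ofLp.1 with ha
  set v : Vec (d + 1) := x.ofLp.2 with hv
  rw [charFun_gaussianReal, charFun_multivariateGaussian
    ((posSemidef_centerMat hd).smul (inv_nonneg.2 hκ.le)),
    Measure.map_map (WithLp.prod_continuous_toLp 2 ℝ (Vec (d + 1))).measurable
      continuous_mean_resid.measurable, charFun_apply,
    integral_map ((WithLp.prod_continuous_toLp 2 ℝ (Vec (d + 1))).comp
      continuous_mean_resid).measurable.aemeasurable (by fun_prop),
    integral_withDensity_eq_integral_toReal_smul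
      (continuous_gaussDens κ).measurable.ennreal_ofReal (by simp)]
  set V := mean fun i : Fin d => v i.succ with hV
  set c : Fin d → ℝ := fun j => a / d + (v j.succ - V) with hc
  have hinner (z : Fin d → ℝ) : inner ℝ ((WithLp.toLp 2 ∘ fun z => (mean z, resid z)) z) x =
      ∑ j, c j * z j := by
    rw [WithLp.prod_inner_apply]
    simp only [Function.comp, ← ha, ← hv]
    rw [PiLp.inner_apply, Fin.sum_univ_succ]
    simp only [resid, RCLike.inner_apply, conj_trivial, Fin.cons_zero, Fin.cons_succ, mul_zero,
      zero_add]
    have h1 : ∑ i : Fin d, v i.succ * (z i - mean z) = ∑ i : Fin d, (v i.succ - V) * z i := by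
      have e1 : ∑ i : Fin d, V * (z i - mean z) = 0 := by
        rw [← Finset.mul_sum, sum_sub_mean hd, mul_zero]
      have e2 : ∑ i : Fin d, (v i.succ - V) * mean z = 0 := by
        rw [← Finset.sum_mul, sum_sub_mean hd, zero_mul]
      rw [← sub_zero (∑ i : Fin d, v i.succ * (z i - mean z)), ← e1, ← Finset.sum_sub_distrib,
        ← sub_zero (∑ i : Fin d, (v i.succ - V) * z i), ← e2, ← Finset.sum_sub_distrib]
      exact Finset.sum_congr rfl fun i _ => by ring
    rw [h1, mean]
    simp only [hc, add_mul, Finset.sum_add_distrib, ← Finset.mul_sum]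
    ring
  have hcsq : ∑ j, c j ^ 2 = a ^ 2 / d + ∑ j : Fin d, (v j.succ - V) ^ 2 := by
    have hm : mean c = a / d := by
      simp only [hc]
      rw [mean_add, mean_const hd, hV, mean_sub_mean hd, add_zero]
    rw [sum_sq_eq hd, hm]
    simp only [hc, add_sub_cancel_left]
    field_simp
  have hκ2 : (0 : ℝ) < ((κ / 2 : ℝ) : ℂ).re := by simpa using hκ
  have hG := GaussianFourier.integral_cexp_neg_mul_sum_add (ι := Fin d) hκ2
    fun j => (c j : ℂ) * Complex.I
  have hpow : ((Real.pi : ℂ) / ((κ / 2 : ℝ) : ℂ)) ^ ((Fintype.card (Fin d) : ℂ) / 2) =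
      (((Real.pi / (κ / 2)) ^ ((d : ℝ) / 2) : ℝ) : ℂ) := by
    rw [Complex.ofReal_cpow (by have := Real.pi_pos; positivity)]
    push_cast
    simp
  have hA : (0 : ℝ) < (Real.pi / (κ / 2)) ^ ((d : ℝ) / 2) := by
    have := Real.pi_pos
    positivity
  calc _ = ∫ z : Fin d → ℝ, (((Real.pi / (κ / 2)) ^ ((d : ℝ) / 2))⁻¹ : ℝ) *
        Complex.exp (-((κ / 2 : ℝ) : ℂ) * ∑ i, (z i : ℂ) ^ 2 +
          ∑ i, (c i : ℂ) * Complex.I * (z i : ℂ)) := by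
        refine integral_congr_ae (Eventually.of_forall fun z => ?_)
        simp only
        rw [hinner, ENNReal.toReal_ofReal (hnn z), Complex.real_smul, gaussDens, Complex.ofReal_mul,
          Complex.ofReal_exp, mul_assoc, ← Complex.exp_add]
        congr 2
        push_cast
        rw [Finset.sum_mul]
        congr 1
        · ring
        · exact Finset.sum_congr rfl fun i _ => by ring
    _ = Complex.exp ((∑ i, ((c i : ℂ) * Complex.I) ^ 2) / (4 * ((κ / 2 : ℝ) : ℂ))) := by
        rw [integral_const_mul, hG, hpow, ← mul_assoc, ← Complex.ofReal_mul,
          inv_mul_cancel₀ hA.ne', Complex.ofReal_one, one_mul]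
    _ = _ := by
        rw [← Complex.exp_add, Real.coe_toNNReal _ (by positivity)]
        congr 1
        have e1 : ∑ i, ((c i : ℂ) * Complex.I) ^ 2 = -((∑ i, c i ^ 2 : ℝ) : ℂ) := by
          push_cast
          rw [← Finset.sum_neg_distrib]
          refine Finset.sum_congr rfl fun i _ => ?_
          rw [mul_pow, Complex.I_sq]
          ring
        rw [e1, hcsq, Matrix.smul_mulVec, dotProduct_smul, dotProduct_centerMat_mulVec hd]
        simp only [inner_zero_right, smul_eq_mul, ← hV]
        have hκ0 : (κ : ℂ) ≠ 0 := by exact_mod_cast hκ.ne'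
        have hd0 : (d : ℂ) ≠ 0 := by exact_mod_cast hd'.ne'
        push_cast
        field_simp
        ring

end

section

variable {p d : ℕ} {β h s : ℝ}

/-! ### Identification of the limit -/

theorem continuous_limitDensity (βbar hbar : ℝ) :
    Continuous (limitDensity p (d + 1) β h βbar hbar s) := by
  unfold limitDensity
  fun_prop

/-- The factor in `mean z ^ 2` is inserted to complete the quadratic form of the residuals to the
full `∑ z i ^ 2`, by Pythagoras. -/
theorem limitDens_eq (hd : 1 ≤ d) (βbar hbar : ℝ) (z : Fin d → ℝ) :
    limitDens p d β h βbar hbar s z =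
      (√2 * √Real.pi) / (∏ r, (√2 * √Real.pi * √(xvec (d + 1) s r))) *
        (limitDensity p (d + 1) β h βbar hbar s (mean z) *
          Real.exp (precision p d β s / 2 * (d * mean z ^ 2))) *
        Real.exp (-(precision p d β s / 2 * ∑ i, z i ^ 2)) := by
  have hquad : kfunD2 p β (tailCoord d s) / 2 * ∑ i, (z i - mean z) ^ 2 =
      -(precision p d β s / 2 * ∑ i, (z i - mean z) ^ 2) := by
    rcases hd.eq_or_lt with rfl | hd2
    · have : ∑ i, (z i - mean z) ^ 2 = 0 := by simp [mean]
      rw [this]; simp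
    · rw [precision, if_pos (show 2 ≤ d from hd2)]; ring
  rw [limitDens, limitWeight, limitDensity, ← Real.exp_add,
    mul_assoc (_ / _) (Real.exp _) (Real.exp _), ← Real.exp_add, hquad,
    sum_sq_eq hd z]
  congr 2
  push_cast
  ring

theorem IsQuarticMax.exists_integral_limitDens (hp : 2 ≤ p) (hd : 1 ≤ d)
    (H : IsQuarticMax p d β h s) (βbar hbar : ℝ) : ∃ K : ℝ, 0 < K ∧
      ∀ g : ℝ × Vec (d + 1) → ℝ, Continuous g →
        ∫ z, limitDens p d β h βbar hbar s z * g (mean z, resid z) =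
          K * ∫ x, limitDensity p (d + 1) β h βbar hbar s x.1 * g x
            ∂((volume : Measure ℝ).prod (multivariateGaussian 0 (limitCov p (d + 1) β s))) := by
  have hd' : (0 : ℝ) < d := by exact_mod_cast hd
  have hκ := H.precision_pos
  set κ := precision p d β s with hκdef
  have hpi := Real.pi_pos
  set A := (Real.pi / (κ / 2)) ^ ((d : ℝ) / 2) with hA
  have hA0 : 0 < A := by positivity
  set C := (√2 * √Real.pi) / (∏ r, (√2 * √Real.pi * √(xvec (d + 1) s r))) with hC
  have hC0 : 0 < C := by
    have : 0 < ∏ r, (√2 * √Real.pi * √(xvec (d + 1) s r)) := Finset.prod_pos fun r _ => by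
      have := Real.sqrt_pos.2 (xvec_pos H.mem r)
      positivity
    positivity
  set v := Real.toNNReal (κ * d)⁻¹ with hv
  have hvR : (v : ℝ) = (κ * d)⁻¹ := Real.coe_toNNReal _ (by positivity)
  have hv0 : v ≠ 0 := by
    rw [hv, Ne, Real.toNNReal_eq_zero, not_le]
    positivity
  refine ⟨C * A * (√(2 * Real.pi * v))⁻¹, by rw [hvR]; positivity, fun g hg => ?_⟩
  have hL := continuous_limitDensity (p := p) (d := d) (β := β) (h := h) (s := s) βbar hbar
  set L := limitDensity p (d + 1) β h βbar hbar s with hLdef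
  set G : ℝ × Vec (d + 1) → ℝ := fun x =>
    C * A * (L x.1 * Real.exp (κ / 2 * (d * x.1 ^ 2))) * g x with hG
  have hGc : Continuous G := by fun_prop
  have hnn (z : Fin d → ℝ) : 0 ≤ gaussDens d κ z := by
    unfold gaussDens; positivity
  calc _ = ∫ z, (ENNReal.ofReal (gaussDens d κ z)).toReal • G (mean z, resid z) := by
        refine integral_congr_ae (Eventually.of_forall fun z => ?_)
        simp only
        rw [ENNReal.toReal_ofReal (hnn z), limitDens_eq hd, gaussDens, smul_eq_mul, ← hA, ← hC,
          ← hκdef, ← hLdef]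
        simp only [hG]
        field_simp
    _ = ∫ x, G x ∂((gaussianReal 0 v).prod (multivariateGaussian 0 (κ⁻¹ • centerMat d))) := by
        rw [← map_mean_resid hd hκ, integral_map continuous_mean_resid.measurable.aemeasurable
          hGc.aestronglyMeasurable, integral_withDensity_eq_integral_toReal_smul
          (continuous_gaussDens κ).measurable.ennreal_ofReal (by simp)]
    _ = _ := by
        rw [gaussianReal_of_var_ne_zero 0 hv0, prod_withDensity_left (measurable_gaussianPDF 0 v),
          integral_withDensity_eq_integral_toReal_smul
            (show Measurable fun x : ℝ × Vec (d + 1) => gaussianPDF 0 v x.1 from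
              (measurable_gaussianPDF 0 v).comp measurable_fst)
            (Eventually.of_forall fun x => gaussianPDF_lt_top), ← integral_const_mul,
          limitCov_eq hp hd H.mem]
        refine integral_congr_ae (Eventually.of_forall fun x => ?_)
        simp only [toReal_gaussianPDF, smul_eq_mul, hG, gaussianPDFReal, sub_zero]
        -- The inserted factor is the reciprocal of the exponential in the Gaussian density of the
        -- mean, which has variance `1 / (κ d)`; Lebesgue measure is left in the first variable.
        have e : Real.exp (-x.1 ^ 2 / (2 * v)) * Real.exp (κ / 2 * (d * x.1 ^ 2)) = 1 := by
          rw [← Real.exp_add, hvR, Real.exp_eq_one_iff]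
          field_simp
          ring
        linear_combination ((√(2 * Real.pi * v))⁻¹ * C * A * L x.1 * g x) * e

/-- The law of the limit of the fluctuations along `u`. -/
noncomputable def limitLaw (p d : ℕ) (β h βbar hbar s : ℝ) : Measure ℝ :=
  (volume : Measure ℝ).withDensity fun x =>
    ENNReal.ofReal ((∫ y, limitDensity p (d + 1) β h βbar hbar s y)⁻¹ *
      limitDensity p (d + 1) β h βbar hbar s x)

/-- Fubini reduces this to the positive integral of `limitDens`, so no separate tail estimate in one
variable is needed. -/
theorem IsQuarticMax.integral_limitDensity_pos (hp : 2 ≤ p) (hd : 1 ≤ d)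
    (H : IsQuarticMax p d β h s) (βbar hbar : ℝ) :
    0 < ∫ y, limitDensity p (d + 1) β h βbar hbar s y := by
  obtain ⟨K, hK, hid⟩ := H.exists_integral_limitDens hp hd βbar hbar
  have h1 := hid (fun _ => 1) continuous_const
  have h2 := integral_prod_mul (μ := (volume : Measure ℝ))
    (ν := multivariateGaussian 0 (limitCov p (d + 1) β s))
    (limitDensity p (d + 1) β h βbar hbar s) (fun _ => (1 : ℝ))
  rw [h2] at h1
  simp only [mul_one, integral_const, probReal_univ, smul_eq_mul] at h1
  have h3 := H.integral_limitDens_pos hp hd βbar hbar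
  rw [h1] at h3
  exact (mul_pos_iff_of_pos_left hK).1 h3

theorem limitDensity_pos (βbar hbar x : ℝ) : 0 < limitDensity p (d + 1) β h βbar hbar s x :=
  Real.exp_pos _

theorem IsQuarticMax.isProbabilityMeasure_limitLaw (hp : 2 ≤ p) (hd : 1 ≤ d)
    (H : IsQuarticMax p d β h s) (βbar hbar : ℝ) :
    IsProbabilityMeasure (limitLaw p d β h βbar hbar s) := by
  have hZ := H.integral_limitDensity_pos hp hd βbar hbar
  have hint : Integrable (limitDensity p (d + 1) β h βbar hbar s) := by
    -- A non-integrable function has integral `0` by convention, so a positive integral implies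
    -- integrability.
    by_contra hcon
    rw [integral_undef hcon] at hZ
    exact lt_irrefl _ hZ
  refine ⟨?_⟩
  rw [limitLaw, withDensity_apply _ MeasurableSet.univ, Measure.restrict_univ,
    ← ofReal_integral_eq_lintegral_ofReal (hint.const_mul _)
      (Eventually.of_forall fun x => mul_nonneg (inv_nonneg.2 hZ.le) (limitDensity_pos _ _ x).le),
    integral_const_mul, inv_mul_cancel₀ hZ.ne', ENNReal.ofReal_one]

theorem IsQuarticMax.integral_limit (hp : 2 ≤ p) (hd : 1 ≤ d) (H : IsQuarticMax p d β h s)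
    (βbar hbar : ℝ) {g : ℝ × Vec (d + 1) → ℝ} (hg : Continuous g) :
    (∫ z, limitDens p d β h βbar hbar s z * g (mean z, resid z)) /
        ∫ z, limitDens p d β h βbar hbar s z =
      ∫ x, g x ∂((limitLaw p d β h βbar hbar s).prod
        (multivariateGaussian 0 (limitCov p (d + 1) β s))) := by
  obtain ⟨K, hK, hid⟩ := H.exists_integral_limitDens hp hd βbar hbar
  have hZ := H.integral_limitDensity_pos hp hd βbar hbar
  have hL := continuous_limitDensity (p := p) (d := d) (β := β) (h := h) (s := s) βbar hbar
  have h1 := hid (fun _ => 1) continuous_const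
  have h2 := integral_prod_mul (μ := (volume : Measure ℝ))
    (ν := multivariateGaussian 0 (limitCov p (d + 1) β s))
    (limitDensity p (d + 1) β h βbar hbar s) (fun _ => (1 : ℝ))
  rw [h2] at h1
  simp only [mul_one, integral_const, probReal_univ, smul_eq_mul] at h1
  have hm : Measurable fun x => ENNReal.ofReal ((∫ y, limitDensity p (d + 1) β h βbar hbar s y)⁻¹ *
      limitDensity p (d + 1) β h βbar hbar s x) :=
    (hL.measurable.const_mul _).ennreal_ofReal
  rw [hid g hg, h1, limitLaw, prod_withDensity_left hm,
    integral_withDensity_eq_integral_toReal_smul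
      (f := fun x : ℝ × Vec (d + 1) => ENNReal.ofReal
        ((∫ y, limitDensity p (d + 1) β h βbar hbar s y)⁻¹ *
          limitDensity p (d + 1) β h βbar hbar s x.1)) (hm.comp measurable_fst)
      (Eventually.of_forall fun _ => ENNReal.ofReal_lt_top), mul_div_mul_left _ _ hK.ne',
    div_eq_inv_mul, ← integral_const_mul]
  refine integral_congr_ae (Eventually.of_forall fun x => ?_)
  simp only
  rw [ENNReal.toReal_ofReal (mul_nonneg (inv_nonneg.2 hZ.le) (limitDensity_pos _ _ _).le),
    smul_eq_mul, mul_assoc]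

/-! ### The decomposition of the magnetization -/

/-- The fluctuation orthogonal to `u`, on the scale `N ^ (-1/2)`. -/
noncomputable def vCoord (d : ℕ) (s : ℝ) {N : ℕ} (X : Fin N → Fin (d + 1)) : Vec (d + 1) :=
  WithLp.toLp 2 (Fin.cons 0 (wCoord d s X))

/-- Subtracting the two linear conditions leaves `(d + 1) v 0 = 0`; this is the origin of the zero
first row and column of the covariance. -/
theorem mem_zeroSum_inf_orthogonal_iff {v : Vec (d + 1)} :
    v ∈ zeroSum (d + 1) ⊓ (Submodule.span ℝ {uvec (d + 1)})ᗮ ↔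
      v 0 = 0 ∧ ∑ i : Fin d, v i.succ = 0 := by
  rw [Submodule.mem_inf, Submodule.mem_orthogonal_singleton_iff_inner_right]
  have h1 : v ∈ zeroSum (d + 1) ↔ v 0 + ∑ i : Fin d, v i.succ = 0 := by
    rw [← Fin.sum_univ_succ]; rfl
  have h2 : inner ℝ (uvec (d + 1)) v = -d * v 0 + ∑ i : Fin d, v i.succ := by
    rw [PiLp.inner_apply, Fin.sum_univ_succ]
    simp [uvec, mul_comm]
  rw [h1, h2]
  constructor
  · rintro ⟨h1, h2⟩
    have : ((d : ℝ) + 1) * v 0 = 0 := by linarith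
    have h0 : v 0 = 0 := (mul_eq_zero.1 this).resolve_left (by positivity)
    exact ⟨h0, by linarith⟩
  · rintro ⟨h1, h2⟩
    rw [h1, h2]
    simp

/-- Averaging the tail coordinates kills `v` and determines `t`; the residuals then determine `v`.
-/
theorem isDecomposition_iff (hd : 1 ≤ d) {N : ℕ} (hN : 1 ≤ N) (X : Fin N → Fin (d + 1)) (t : ℝ)
    (v : Vec (d + 1)) : IsDecomposition (d + 1) N (xvec (d + 1) s) X t v ↔
      t = tCoord d s X ∧ v = vCoord d s X := by
  have hN' : (0 : ℝ) < N := by exact_mod_cast hN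
  have hd' : (0 : ℝ) < d := by exact_mod_cast hd
  have e1 : (N : ℝ) ^ (1 / 4 : ℝ) * (N : ℝ) ^ (-(1 / 4) : ℝ) = 1 := by
    rw [← Real.rpow_add hN']; norm_num
  have e2 : (N : ℝ) ^ (1 / 2 : ℝ) * (N : ℝ) ^ (-(1 / 2) : ℝ) = 1 := by
    rw [← Real.rpow_add hN']; norm_num
  rw [IsDecomposition, mem_zeroSum_inf_orthogonal_iff]
  constructor
  · rintro ⟨⟨hv0, hvs⟩, hdec⟩
    have hcoord (i : Fin d) : magnetization (d + 1) N X i.succ - tailCoord d s =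
        (N : ℝ) ^ (-(1 / 4) : ℝ) * t + (N : ℝ) ^ (-(1 / 2) : ℝ) * v i.succ := by
      have := congrArg (fun y : Vec (d + 1) => y i.succ) hdec
      simpa [uvec] using this
    have hmean : (mean fun i : Fin d => magnetization (d + 1) N X i.succ - tailCoord d s) =
        (N : ℝ) ^ (-(1 / 4) : ℝ) * t := by
      simp only [hcoord]
      rw [mean_add, mean_const hd, mean_const_mul, mean, hvs, zero_div, mul_zero, add_zero]
    refine ⟨?_, ?_⟩
    · rw [tCoord, hmean, ← mul_assoc, e1, one_mul]
    · ext r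
      refine Fin.cases ?_ (fun i => ?_) r
      · simpa [vCoord] using hv0
      · simp only [vCoord, Fin.cons_succ, wCoord]
        rw [hmean, hcoord, add_sub_cancel_left, ← mul_assoc, e2, one_mul]
  · rintro ⟨rfl, rfl⟩
    refine ⟨⟨by simp [vCoord], by simpa [vCoord] using sum_wCoord hd X⟩, ?_⟩
    rw [magnetization_eq_shiftVec (s := s) hd (by omega) X]
    ext r
    refine Fin.cases ?_ (fun i => ?_) r
    · simp [vCoord, uvec]
      ring
    · simp [vCoord, uvec]
      ring

theorem IsQuarticMax.tendstoInDistribution (hp : 2 ≤ p) (hd : 1 ≤ d) (H : IsQuarticMax p d β h s)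
    (βbar hbar : ℝ) [IsProbabilityMeasure (limitLaw p d β h βbar hbar s)]
    {TN : (N : ℕ) → (Fin N → Fin (d + 1)) → ℝ}
    {VN : (N : ℕ) → (Fin N → Fin (d + 1)) → Vec (d + 1)}
    (hdec : ∀ N : ℕ, 1 ≤ N → ∀ X : Fin N → Fin (d + 1),
      IsDecomposition (d + 1) N (xvec (d + 1) s) X (TN N X) (VN N X)) :
    TendstoInDistribution (fun N X => (TN N X, VN N X)) atTop
      (fun ω : ℝ × Vec (d + 1) => (ω.1, ω.2))
      (fun N : ℕ => pottsMeasure p (d + 1) (β + (N : ℝ) ^ (-(3 / 4) : ℝ) * βbar)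
        (h + (N : ℝ) ^ (-(3 / 4) : ℝ) * hbar) N)
      ((limitLaw p d β h βbar hbar s).prod
        (multivariateGaussian 0 (limitCov p (d + 1) β s))) := by
  refine ⟨fun N => (Measurable.of_discrete).aemeasurable, by fun_prop, ?_⟩
  refine ProbabilityMeasure.tendsto_iff_forall_integral_tendsto.2 fun f => ?_
  have hcons : Continuous fun x : ℝ × (Fin d → ℝ) =>
      (x.1, (WithLp.toLp 2 (Fin.cons 0 x.2) : Vec (d + 1))) := by
    refine continuous_fst.prodMk ((PiLp.continuous_toLp 2 _).comp (continuous_pi fun r => ?_))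
    refine Fin.cases ?_ (fun i => ?_) r
    · simpa using continuous_const
    · simp only [Fin.cons_succ]
      fun_prop
  have hlim := H.tendsto_expectation hp hd βbar hbar (f.continuous.comp hcons) (B := ‖f‖)
    fun x => f.norm_coe_le_norm _
  have hval := H.integral_limit hp hd βbar hbar f.continuous
  have hR : ∫ ω, f ω ∂(((limitLaw p d β h βbar hbar s).prod
      (multivariateGaussian 0 (limitCov p (d + 1) β s))).map fun ω => (ω.1, ω.2)) =
      ∫ ω, f ω ∂((limitLaw p d β h βbar hbar s).prod
        (multivariateGaussian 0 (limitCov p (d + 1) β s))) := by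
    simp only [Prod.mk.eta, Measure.map_id']
  refine Tendsto.congr' ?_ (hlim.trans (le_of_eq (congrArg 𝓝 (hval.trans hR.symm))))
  -- The decomposition is assumed only from `N = 1` on, so the values at `N = 0` are discarded.
  filter_upwards [eventually_ge_atTop 1] with N hN
  rw [ProbabilityMeasure.coe_mk, integral_map (Measurable.of_discrete).aemeasurable
    f.continuous.aestronglyMeasurable]
  refine integral_congr_ae (Eventually.of_forall fun X => ?_)
  obtain ⟨h1, h2⟩ := (isDecomposition_iff hd hN X _ _).1 (hdec N hN X)
  simp only [h1, h2]
  rfl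

end

end Potts

/-! ### The main theorem: the limits are the projections of a product space, and the marginal
convergences follow from the joint one by continuous mapping. -/

theorem theorem2p4 (p q : ℕ) [NeZero q] (hp : 2 ≤ p) (hq : 2 ≤ q) (β h : ℝ)
    (hI : Potts.IsTypeISpecial p q β h) (βbar hbar : ℝ)
    (m : Potts.Vec q) (hm : Potts.IsGlobalMaximizer p q β h m) :
    ∃ s ∈ Set.Ico (0 : ℝ) 1, m = Potts.xvec q s ∧
      -- existence and uniqueness of the decomposition
      (∀ N : ℕ, 1 ≤ N → ∀ X : Fin N → Fin q,
        ∃! tv : ℝ × Potts.Vec q, Potts.IsDecomposition q N m X tv.1 tv.2) ∧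
      -- the limiting covariance matrix is a covariance matrix of rank `q - 2`
      (Potts.limitCov p q β s).PosSemidef ∧ (Potts.limitCov p q β s).rank = q - 2 ∧
      -- the limits `T` and `V`, independent, on one probability space
      ∃ (Ω : Type) (_ : MeasurableSpace Ω) (P : Measure Ω) (_ : IsProbabilityMeasure P)
        (T : Ω → ℝ) (V : Ω → Potts.Vec q),
        (∃ c : ℝ, 0 < c ∧ HasLaw T ((volume : Measure ℝ).withDensity fun x =>
          ENNReal.ofReal (c * Potts.limitDensity p q β h βbar hbar s x)) P) ∧
        HasLaw V (multivariateGaussian 0 (Potts.limitCov p q β s)) P ∧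
        IndepFun T V P ∧
        -- convergence in distribution under the perturbed measures, separately and jointly
        ∀ (TN : (N : ℕ) → (Fin N → Fin q) → ℝ) (VN : (N : ℕ) → (Fin N → Fin q) → Potts.Vec q),
          (∀ N : ℕ, 1 ≤ N → ∀ X : Fin N → Fin q,
            Potts.IsDecomposition q N m X (TN N X) (VN N X)) →
          TendstoInDistribution TN atTop T
            (fun N : ℕ => Potts.pottsMeasure p q (β + (N : ℝ) ^ (-(3 / 4) : ℝ) * βbar)
              (h + (N : ℝ) ^ (-(3 / 4) : ℝ) * hbar) N) P ∧
          TendstoInDistribution VN atTop V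
            (fun N : ℕ => Potts.pottsMeasure p q (β + (N : ℝ) ^ (-(3 / 4) : ℝ) * βbar)
              (h + (N : ℝ) ^ (-(3 / 4) : ℝ) * hbar) N) P ∧
          TendstoInDistribution (fun N X => (TN N X, VN N X)) atTop (fun ω => (T ω, V ω))
            (fun N : ℕ => Potts.pottsMeasure p q (β + (N : ℝ) ^ (-(3 / 4) : ℝ) * βbar)
              (h + (N : ℝ) ^ (-(3 / 4) : ℝ) * hbar) N) P := by
  obtain ⟨d, rfl⟩ : ∃ d, q = d + 1 := ⟨q - 1, by omega⟩
  have hd : 1 ≤ d := by omega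
  obtain ⟨s, hs, H⟩ := Potts.IsQuarticMax.of_special hp hd hI
  obtain rfl := H.unique m hm
  have hcov := Potts.limitCov_eq (β := β) hp hd H.mem
  have hκ := H.precision_pos
  have hlaw := H.isProbabilityMeasure_limitLaw hp hd βbar hbar
  refine ⟨s, hs, rfl, fun N hN X => ?_, ?_, ?_, ℝ × Potts.Vec (d + 1), inferInstance,
    (Potts.limitLaw p d β h βbar hbar s).prod
      (multivariateGaussian 0 (Potts.limitCov p (d + 1) β s)), inferInstance, Prod.fst, Prod.snd,
    ⟨_, inv_pos.2 (H.integral_limitDensity_pos hp hd βbar hbar), measurable_fst.aemeasurable,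
      measurePreserving_fst.map_eq⟩, ⟨measurable_snd.aemeasurable, measurePreserving_snd.map_eq⟩,
    indepFun_prod measurable_id measurable_id, fun TN VN hdec => ?_⟩
  · refine ⟨(Potts.tCoord d s X, Potts.vCoord d s X),
      (Potts.isDecomposition_iff hd hN X _ _).2 ⟨rfl, rfl⟩, fun tv htv => ?_⟩
    obtain ⟨h1, h2⟩ := (Potts.isDecomposition_iff hd hN X _ _).1 htv
    exact Prod.ext h1 h2
  · rw [hcov]
    exact (Potts.posSemidef_centerMat hd).smul (inv_nonneg.2 hκ.le)
  · rw [hcov, Matrix.rank_smul_of_mem_nonZeroDivisors _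
      (mem_nonZeroDivisors_of_ne_zero (inv_pos.2 hκ).ne'), Potts.rank_centerMat hd]
    omega
  · have hjoint := H.tendstoInDistribution hp hd βbar hbar hdec
    exact ⟨hjoint.continuous_comp continuous_fst, hjoint.continuous_comp continuous_snd, hjoint⟩
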